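/- **Conventions.** Simplicial complexes are abstract, and $|\Sigma|$ is the geometric realization in barycentric coordinates. The link of a face $\sigma$ of $\Sigma$ is $\mathrm{lk}_\Sigma(\sigma)=\{\tau \mid \tau\cup\sigma\in\Sigma,\ \tau\cap\sigma=\varnothing\}$. A *combinatorial $d$-manifold* (possibly with boundary, possibly empty) is a simplicial complex in which the link of every vertex is a combinatorial $(d-1)$-sphere or a combinatorial $(d-1)$-disk. Here a combinatorial $n$-sphere is a combinatorial $n$-manifold with all vertex links combinatorial $(n-1)$-spheres that is PL-homeomorphic to the boundary of the $(n+1)$-simplex, and a combinatorial $n$-disk ($n\ge 0$) is a combinatorial $n$-manifold PL-homeomorphic to the $n$-simplex; the $(-1)$-sphere is the empty complex and there is no $(-1)$-disk. The boundary $\partial M$ consists of all simplices of $M$ whose link is a combinatorial disk. Let $c$ be a map from the vertices of $M$ to a set of $k$ colors. It induces the Voronoi coloring of $|M|$: a point $x$ with barycentric coordinates $(x_0,\dots,x_r)$ in a simplex $v_0\cdots v_r$ of $M$ is assigned the set of colors $$c(x)=\{c(v_i) \mid x_i=\max_j x_j\}.$$ For a set $C$ of $m$ colors, the corresponding *$m$-color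 class* is $X=\{x\in|M| \mid C\subseteq c(x)\}$. **Lemma 2.4.** Let $1\le m\le k\le d$, let $M$ be a combinatorial $d$-manifold whose vertices are colored with $k$ colors, and let $X\subseteq |M|$ be the $m$-color class of a set $C$ of $m$ of the $k$ colors. Then $X$ is a union of simplices of the barycentric subdivision $M'$ of $M$ that form a (possibly empty) combinatorial $(d-m+1)$-manifold, as a subcomplex of $M'$. Furthermore, as subsets of $|M|$, $$\partial X=(X\cap\partial M)\cup X^+,\qquad X^+=\{x\in X \mid c(x)\text{ has more than } m \text{ elements}\}.$$ -/

import Mathlib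

/-! Combinatorial (PL) manifolds, barycentric subdivision and Voronoi colorings of abstract
simplicial complexes. A simplicial complex is a `PreAbstractSimplicialComplex V`: a downward closed
set of nonempty finite subsets of `V`, whose vertices are the `v` with `{v}` a face. -/

noncomputable section

namespace VoronoiColoring

/-! ### Geometric realization, in barycentric coordinates -/

/-- The closed geometric simplex `|s|`: barycentric coordinates on the vertex set `s`. -/
def geomSimplex {V : Type*} (s : Finset V) : Set (V →₀ ℝ) :=
  {x | (∀ v, 0 ≤ x v) ∧ x.support ⊆ s ∧ ∑ v ∈ s, x v = 1}

/-- The union of the geometric simplices of a set of faces. For the set of faces of a simplicial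
complex `K` this is its geometric realization `|K|`. -/
def space {V : Type*} (F : Set (Finset V)) : Set (V →₀ ℝ) :=
  ⋃ s ∈ F, geomSimplex s

/-! ### Piecewise linear homeomorphisms -/

/-- A convex polyhedron: an intersection of finitely many closed half-spaces. -/
def IsConvexPolyhedron {E : Type*} [AddCommGroup E] [Module ℝ E] (P : Set E) : Prop :=
  ∃ H : Set (Module.Dual ℝ E × ℝ), H.Finite ∧ P = {x | ∀ h ∈ H, h.1 x ≤ h.2}

/-- `f` is piecewise linear on `S`: finitely many convex polyhedra cover `S`, and on the part of `S`
in each of them `f` agrees with an affine map. (As the pieces are closed, `f` is then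
continuous on `S` whenever `S` is a finite polyhedron.) -/
def IsPLOn {E F : Type*} [AddCommGroup E] [Module ℝ E] [AddCommGroup F] [Module ℝ F]
    (f : E → F) (S : Set E) : Prop :=
  ∃ Q : Set (Set E), Q.Finite ∧ S ⊆ ⋃₀ Q ∧
    ∀ P ∈ Q, IsConvexPolyhedron P ∧ ∃ A : E →ᵃ[ℝ] F, Set.EqOn f A (S ∩ P)

/-- `|K|` and `|L|` are PL-homeomorphic: there are mutually inverse PL maps between them. It is used
only when `L` is a finite complex, and then it forces `K` to be finite as well. -/
def PLHomeomorphic {V W : Type*} (K : PreAbstractSimplicialComplex V)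
    (L : PreAbstractSimplicialComplex W) : Prop :=
  ∃ (f : (V →₀ ℝ) → (W →₀ ℝ)) (g : (W →₀ ℝ) → (V →₀ ℝ)),
    Set.MapsTo f (space K.faces) (space L.faces) ∧
    Set.MapsTo g (space L.faces) (space K.faces) ∧
    Set.InvOn g f (space K.faces) (space L.faces) ∧
    IsPLOn f (space K.faces) ∧ IsPLOn g (space L.faces)

/-! ### Combinatorial manifolds -/

/-- The `n`-dimensional simplex, with all its faces. -/
def simplex (n : ℕ) : PreAbstractSimplicialComplex (Fin (n + 1)) where
  faces := {s | s.Nonempty}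
  isRelLowerSet_faces := fun _ hs => ⟨hs, fun _ _ ht => ht⟩

/-- The boundary of the `n`-dimensional simplex: all its proper faces. It is empty for `n = 0`. -/
def simplexBoundary (n : ℕ) : PreAbstractSimplicialComplex (Fin (n + 1)) where
  faces := {s | s.Nonempty ∧ s ≠ Finset.univ}
  isRelLowerSet_faces := fun _ hs => ⟨hs.1, fun _ hts ht =>
    ⟨ht, fun h => hs.2 (Finset.univ_subset_iff.1 (h ▸ hts))⟩⟩

open Classical in
/-- The link of `s` in `K`: the faces `t` disjoint from `s` such that `t ∪ s` is a face of `K`. -/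
def link {V : Type*} (K : PreAbstractSimplicialComplex V) (s : Finset V) :
    PreAbstractSimplicialComplex V where
  faces := {t | t.Nonempty ∧ Disjoint t s ∧ t ∪ s ∈ K.faces}
  isRelLowerSet_faces := fun _ h => ⟨h.1, fun _ hts ht =>
    ⟨ht, Finset.disjoint_of_subset_left hts h.2.1,
      (K.isRelLowerSet_faces h.2.2).2 (Finset.union_subset_union_left hts)
        (ht.mono Finset.subset_union_left)⟩⟩

/-- `IsCombSphere r K`: the complex `K` is a combinatorial sphere of dimension `r - 1`, that is, a
combinatorial `(r - 1)`-manifold (the link of each vertex is a combinatorial `(r - 2)`-sphere)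
PL-homeomorphic to the boundary of the `r`-simplex. The `(-1)`-sphere (`r = 0`) is the empty
complex. -/
def IsCombSphere {V : Type*} : ℕ → PreAbstractSimplicialComplex V → Prop
  | 0, K => K.faces = ∅
  | r + 1, K => (∀ v, {v} ∈ K.faces → IsCombSphere r (link K {v})) ∧
      PLHomeomorphic K (simplexBoundary (r + 1))

/-- `IsCombDisk r K`: the complex `K` is a combinatorial disk of dimension `r - 1`, that is, a
combinatorial `(r - 1)`-manifold with boundary (the link of each vertex is a combinatorial
`(r - 2)`-sphere or `(r - 2)`-disk) PL-homeomorphic to the `(r - 1)`-simplex. There is no disk of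
dimension `-1` (`r = 0`). -/
def IsCombDisk {V : Type*} : ℕ → PreAbstractSimplicialComplex V → Prop
  | 0, _ => False
  | r + 1, K => (∀ v, {v} ∈ K.faces → IsCombSphere r (link K {v}) ∨ IsCombDisk r (link K {v})) ∧
      PLHomeomorphic K (simplex r)

/-- A combinatorial `d`-manifold, possibly with boundary, possibly empty: the link of every vertex
is a combinatorial `(d - 1)`-sphere or a combinatorial `(d - 1)`-disk. -/
def IsCombManifold {V : Type*} (d : ℕ) (K : PreAbstractSimplicialComplex V) : Prop :=
  ∀ v, {v} ∈ K.faces → IsCombSphere d (link K {v}) ∨ IsCombDisk d (link K {v})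

/-- The simplices of the boundary `∂K` of a combinatorial manifold `K`: those whose link is a
combinatorial disk. -/
def boundary {V : Type*} (K : PreAbstractSimplicialComplex V) : Set (Finset V) :=
  {s | s ∈ K.faces ∧ ∃ r, IsCombDisk r (link K s)}

/-! ### Barycentric subdivision -/

/-- The barycentric subdivision: its vertices are the faces of `K` (standing for their barycenters)
and its faces are the nonempty finite chains of faces of `K`. -/
def barycentricSubdivision {V : Type*} (K : PreAbstractSimplicialComplex V) :
    PreAbstractSimplicialComplex (Finset V) where
  faces := {S | S.Nonempty ∧ (∀ s ∈ S, s ∈ K.faces) ∧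
    ∀ s ∈ S, ∀ t ∈ S, s ⊆ t ∨ t ⊆ s}
  isRelLowerSet_faces := fun _ h => ⟨h.1, fun _ hts ht =>
    ⟨ht, fun s hs => h.2.1 s (hts hs),
      fun s hs t ht => h.2.2 s (hts hs) t (hts ht)⟩⟩

/-- The barycenter of the geometric simplex `|s|`. -/
def barycenter {V : Type*} (s : Finset V) : V →₀ ℝ :=
  ∑ v ∈ s, Finsupp.single v ((s.card : ℝ)⁻¹)

/-- The subset of `|K|` covered by a set `F` of simplices of the barycentric subdivision of `K`: the
image of their realization under the map that is linear on each simplex and sends the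
vertex `s` to the barycenter of `|s|`. -/
def subdivisionSpace {V : Type*} (F : Set (Finset (Finset V))) : Set (V →₀ ℝ) :=
  Finsupp.linearCombination ℝ (barycenter (V := V)) '' space F

/-! ### Voronoi colorings -/

/-- The Voronoi coloring induced by a vertex coloring `c`: the point `x` gets the colors of the
vertices at which its barycentric coordinates are maximal. -/
def voronoiColors {V κ : Type*} (c : V → κ) (x : V →₀ ℝ) : Set κ :=
  {j | ∃ v ∈ x.support, (∀ w, x w ≤ x v) ∧ c v = j}

/-- The color class of a set `C` of colors: the points of `|K|` that have all the colors in `C`, and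
possibly others as well. -/
def colorClass {V κ : Type*} (K : PreAbstractSimplicialComplex V) (c : V → κ) (C : Set κ) :
    Set (V →₀ ℝ) :=
  {x ∈ space K.faces | C ⊆ voronoiColors c x}

end VoronoiColoring

end

open VoronoiColoring

/-!
# Color classes of Voronoi colorings

A point in the interior of the simplex of a chain `s₀ ⊂ ⋯ ⊂ sᵣ` of faces of `M` has its largest
coordinates exactly on `s₀` (`voronoiColors_baryMap`). Hence the color class of `C` is the realization
of the order complex `X` of the set of those faces that have all the colors of `C` (`colorfulFaces`).

The link of a vertex `s` of `X` is the join of what lies below `s` and of what lies above `s`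
(`link_chains_iso`). The faces above `s` form the barycentric subdivision of the link of `s` in `M`
(`chains_above_iso`). The proper colorful subsets of `s` are, by taking complements in `s`, the
nonempty subsets of `s` whose removal leaves all the colors of `C` (`removableFaces_iso_below`). They
form the join of the boundaries of the simplices on the color classes of `s`, one for each color of
`C`, and of the full simplex on the vertices of `s` of other colors
(`isCombSphereOrDisk_removableFaces`), which is a sphere if there are no such vertices and a disk
otherwise. So the link of `s` in `X` is a sphere or a disk, and it is a disk if and only if `s` has
colors outside `C` or lies in `∂M`. The same reasoning for the link of a chain
(`exists_isCombSphereOrDisk_link`) describes the boundary of `X`.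

This uses three facts about combinatorial spheres and disks.
* Joins of spheres and disks are spheres or disks, and the join is a sphere only if both factors are
  (`IsCombSphereOrDisk.join`). For the PL homeomorphism type, a PL map of realizations extends
  homogeneously to the cones over them, which turns it into a map of joins, and the join of the
  boundary of a simplex with a simplex or with the boundary of a simplex is a stellar subdivision of
  a simplex or of its boundary.
* Barycentric subdivision preserves spheres and disks (`IsCombSphereOrDisk.barycentricSubdivision`).
* A sphere is not a disk (`IsCombSphere.not_isCombDisk`). A PL homeomorphism preserves the Euler
  characteristic, computed from the nerve of a cover by compact convex sets
  (`nerveEuler_eq_of_iUnion_eq`), which is `1` for a simplex but not for its boundary. That the Euler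
  characteristic does not depend on the cover follows from Hadwiger's induction over the slices by
  parallel hyperplanes (`sum_nonempty_eq_zero_of_sum_mem_eq_zero`).
-/

namespace VoronoiColoring

/-! ### The Euler relation for compact convex sets -/

open Classical in
/-- The Euler relation on the line. At each `t`, comparing the given relation at `t` and just after
`t` leaves the intervals that end at `t`. -/
theorem sum_eq_zero_of_sum_Icc_eq_zero {ι : Type*} (s : Finset ι) (a b : ι → ℝ) (α : ι → ℤ)
    (hab : ∀ i ∈ s, a i ≤ b i)
    (h : ∀ t : ℝ, ∑ i ∈ s with t ∈ Set.Icc (a i) (b i), α i = 0) : ∑ i ∈ s, α i = 0 := by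
  rw [← Finset.sum_fiberwise_of_maps_to (t := s.image b) (g := b)
    (fun i hi => Finset.mem_image_of_mem b hi)]
  refine Finset.sum_eq_zero fun t _ => ?_
  -- a point `u > t` with no endpoint of an interval in `(t, u]`
  obtain ⟨u, htu, hu⟩ : ∃ u, t < u ∧ ∀ z ∈ s.image a ∪ s.image b, t < z → u < z := by
    have key : ∀ Z : Finset ℝ, ∃ u, t < u ∧ ∀ z ∈ Z, t < z → u < z := by
      intro Z
      induction Z using Finset.induction_on with
      | empty => exact ⟨t + 1, by linarith, by simp⟩
      | insert z Z _ ih =>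
        obtain ⟨u, hu, hZ⟩ := ih
        by_cases hz : t < z
        · refine ⟨min u ((t + z) / 2), lt_min hu (by linarith), fun y hy hty => ?_⟩
          rcases Finset.mem_insert.1 hy with rfl | hy
          · exact (min_le_right _ _).trans_lt (by linarith)
          · exact (min_le_left _ _).trans_lt (hZ y hy hty)
        · refine ⟨u, hu, fun y hy hty => ?_⟩
          rcases Finset.mem_insert.1 hy with rfl | hy
          · exact absurd hty hz
          · exact hZ y hy hty
    exact key _
  have h1 := h t
  have h2 := h u
  have hsplit : (s.filter fun i => t ∈ Set.Icc (a i) (b i)) =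
      (s.filter fun i => b i = t) ∪ (s.filter fun i => u ∈ Set.Icc (a i) (b i)) := by
    ext i
    simp only [Finset.mem_filter, Finset.mem_union, Set.mem_Icc]
    constructor
    · rintro ⟨hi, h3, h4⟩
      rcases h4.eq_or_lt with h5 | h5
      · exact Or.inl ⟨hi, h5.symm⟩
      · exact Or.inr ⟨hi, h3.trans htu.le, (hu _ (Finset.mem_union_right _
          (Finset.mem_image_of_mem b hi)) h5).le⟩
    · rintro (⟨hi, h3⟩ | ⟨hi, h3, h4⟩)
      · exact ⟨hi, h3 ▸ hab i hi, h3.ge⟩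
      · refine ⟨hi, ?_, htu.le.trans h4⟩
        by_contra hc
        exact absurd h3 (not_le.2 (hu _ (Finset.mem_union_left _
          (Finset.mem_image_of_mem a hi)) (not_le.1 hc)))
  rw [hsplit, Finset.sum_union, h2, add_zero] at h1
  · exact h1
  · rw [Finset.disjoint_filter]
    rintro i _ rfl ⟨_, h4⟩
    exact absurd h4 (not_le.2 htu)

open Classical in
/-- The Euler characteristic is a well-defined valuation: a linear relation between indicator
functions of compact convex sets is also satisfied by the constant value `1` on the nonempty ones.
Hadwiger's proof, by induction on the dimension over the slices by parallel hyperplanes. -/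
theorem sum_nonempty_eq_zero_of_sum_mem_eq_zero {ι : Type*} (s : Finset ι) (α : ι → ℤ) (n : ℕ)
    (K : ι → Set (Fin n → ℝ)) (hc : ∀ i ∈ s, IsCompact (K i)) (hv : ∀ i ∈ s, Convex ℝ (K i))
    (h : ∀ x, ∑ i ∈ s with x ∈ K i, α i = 0) : ∑ i ∈ s with (K i).Nonempty, α i = 0 := by
  induction n with
  | zero =>
    rw [← h default]
    congr 1
    ext i
    simp only [Finset.mem_filter, and_congr_right_iff]
    intro _
    exact ⟨fun ⟨y, hy⟩ => Subsingleton.elim y default ▸ hy, fun hy => ⟨_, hy⟩⟩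
  | succ n ih =>
    have hcons : ∀ t : ℝ, Topology.IsClosedEmbedding
        (fun y : Fin n → ℝ => (Fin.cons t y : Fin (n + 1) → ℝ)) := by
      intro t
      refine Topology.IsClosedEmbedding.of_continuous_injective_isClosedMap ?_ ?_ ?_
      · exact Continuous.finCons continuous_const continuous_id
      · exact Fin.cons_right_injective (α := fun _ => ℝ) t
      · intro S hS
        have : (fun y : Fin n → ℝ => (Fin.cons t y : Fin (n + 1) → ℝ)) '' S =
            {x | x 0 = t} ∩ (fun x : Fin (n + 1) → ℝ => fun j : Fin n => x j.succ) ⁻¹' S := by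
          ext x
          constructor
          · rintro ⟨y, hy, rfl⟩
            exact ⟨by simp, by simpa using hy⟩
          · rintro ⟨rfl, hx⟩
            exact ⟨_, hx, Fin.cons_self_tail x⟩
        rw [this]
        refine (isClosed_eq (continuous_apply 0) continuous_const).inter ?_
        exact hS.preimage (by fun_prop)
    -- the induction hypothesis in each slice yields a relation between intervals on the first axis
    have hslice : ∀ t : ℝ, ∑ i ∈ s with t ∈ (fun x : Fin (n + 1) → ℝ => x 0) '' K i, α i = 0 := by
      intro t
      have := ih (fun i => (fun y : Fin n → ℝ => (Fin.cons t y : Fin (n + 1) → ℝ)) ⁻¹' K i)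
        (fun i hi => (hcons t).isCompact_preimage (hc i hi)) ?_ (fun y => h _)
      · convert this using 3 with i
        constructor
        · rintro ⟨x, hx, rfl⟩
          exact ⟨Fin.tail x, by simpa using hx⟩
        · rintro ⟨y, hy⟩
          exact ⟨_, hy, by simp⟩
      · intro i hi y hy z hz p q hp hq hpq
        have := hv i hi hy hz hp hq hpq
        simp only [Set.mem_preimage]
        convert this using 1
        ext j
        refine Fin.cases ?_ (fun j => ?_) j
        · simp [← add_mul, hpq]
        · simp
    have hIcc : ∀ i ∈ s, (K i).Nonempty → ∃ a b : ℝ, a ≤ b ∧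
        (fun x : Fin (n + 1) → ℝ => x 0) '' K i = Set.Icc a b := by
      intro i hi hne
      have h1 := (hc i hi).image (f := fun x : Fin (n + 1) → ℝ => x 0) (by fun_prop)
      have h2 : IsConnected ((fun x : Fin (n + 1) → ℝ => x 0) '' K i) :=
        ((hv i hi).isConnected hne).image _ (by fun_prop)
      have h3 := eq_Icc_of_connected_compact h2 h1
      refine ⟨_, _, ?_, h3⟩
      rw [← Set.nonempty_Icc, ← h3]
      exact hne.image _
    choose! a b hab hI using hIcc
    refine sum_eq_zero_of_sum_Icc_eq_zero _ a b α
      (fun i hi => hab i (Finset.mem_filter.1 hi).1 (Finset.mem_filter.1 hi).2) fun t => ?_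
    rw [← hslice t, Finset.filter_filter]
    congr 1
    ext i
    simp only [Finset.mem_filter, and_congr_right_iff]
    intro hi
    constructor
    · rintro ⟨h1, h2⟩
      rwa [hI i hi h1]
    · intro h1
      have hne : (K i).Nonempty := Set.image_nonempty.1 ⟨t, h1⟩
      exact ⟨hne, hI i hi hne ▸ h1⟩

open Classical in
/-- The Euler characteristic of the nerve of a finite family of sets, the simplex of index sets `I`
counted as `(-1) ^ (|I| + 1)`. -/
noncomputable def nerveEuler {ι E : Type*} [Fintype ι] (K : ι → Set E) : ℤ :=
  ∑ I : Finset ι with I.Nonempty ∧ (⋂ i ∈ I, K i).Nonempty, (-1) ^ (I.card + 1)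

open Classical in
theorem sum_nonempty_neg_one_pow {ι : Type*} [Fintype ι] (J : Finset ι) :
    (∑ I : Finset ι with I.Nonempty ∧ I ⊆ J, (-1 : ℤ) ^ (I.card + 1)) =
      if J.Nonempty then 1 else 0 := by
  have h := Finset.sum_powerset_neg_one_pow_card (x := J)
  have h2 : (Finset.univ.filter fun I : Finset ι => I.Nonempty ∧ I ⊆ J) = J.powerset.erase ∅ := by
    ext I
    simp [Finset.nonempty_iff_ne_empty]
  rw [h2]
  have h3 := Finset.add_sum_erase J.powerset (fun I : Finset ι => (-1 : ℤ) ^ (I.card + 1))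
    (Finset.empty_mem_powerset J)
  have h4 : ∑ I ∈ J.powerset, (-1 : ℤ) ^ (I.card + 1) = - ∑ I ∈ J.powerset, (-1 : ℤ) ^ I.card := by
    rw [← Finset.sum_neg_distrib]
    exact Finset.sum_congr rfl fun I _ => by ring
  rw [h4, h] at h3
  rcases J.eq_empty_or_nonempty with rfl | hJ
  · simp
  · simp only [hJ, if_true, hJ.ne_empty, if_false, Finset.card_empty] at h3 ⊢
    rw [zero_add, pow_one] at h3
    linarith

open Classical in
theorem sum_mem_biInter_neg_one_pow {ι E : Type*} [Fintype ι] (K : ι → Set E) (x : E) :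
    (∑ I : Finset ι with I.Nonempty ∧ x ∈ ⋂ i ∈ I, K i, (-1 : ℤ) ^ (I.card + 1)) =
      if x ∈ ⋃ i, K i then 1 else 0 := by
  have := sum_nonempty_neg_one_pow (Finset.univ.filter fun i => x ∈ K i)
  convert this using 3 with I
  · simp [Finset.subset_iff]
  · simp [Finset.Nonempty]

theorem isCompact_biInter_finset {ι E : Type*} [TopologicalSpace E] [T2Space E] {K : ι → Set E}
    (hK : ∀ i, IsCompact (K i)) {I : Finset ι} (hI : I.Nonempty) : IsCompact (⋂ i ∈ I, K i) := by
  obtain ⟨i, hi⟩ := hI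
  refine (hK i).of_isClosed_subset ?_ (Set.biInter_subset_of_mem hi)
  exact isClosed_biInter fun i _ => (hK i).isClosed

/-- The Euler characteristic of a finite union of compact convex sets, read off the nerve of the
cover, does not depend on the cover. -/
theorem nerveEuler_eq_of_iUnion_eq {ι κ : Type*} [Fintype ι] [Fintype κ] {n : ℕ}
    (K : ι → Set (Fin n → ℝ)) (L : κ → Set (Fin n → ℝ))
    (hKc : ∀ i, IsCompact (K i)) (hKv : ∀ i, Convex ℝ (K i))
    (hLc : ∀ i, IsCompact (L i)) (hLv : ∀ i, Convex ℝ (L i))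
    (h : ⋃ i, K i = ⋃ j, L j) : nerveEuler K = nerveEuler L := by
  classical
  set F : Finset ι ⊕ Finset κ → Set (Fin n → ℝ) :=
    Sum.elim (fun I => ⋂ i ∈ I, K i) (fun I => ⋂ i ∈ I, L i) with hF
  set α : Finset ι ⊕ Finset κ → ℤ :=
    Sum.elim (fun I => (-1) ^ (I.card + 1)) (fun I => -(-1) ^ (I.card + 1)) with hα
  set s : Finset (Finset ι ⊕ Finset κ) :=
    ((Finset.univ.filter fun I : Finset ι => I.Nonempty)).disjSum
      (Finset.univ.filter fun I : Finset κ => I.Nonempty) with hs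
  have hsplit : ∀ p : Set (Fin n → ℝ) → Prop, ∑ i ∈ s with p (F i), α i =
      (∑ I : Finset ι with I.Nonempty ∧ p (⋂ i ∈ I, K i), (-1 : ℤ) ^ (I.card + 1)) -
        ∑ I : Finset κ with I.Nonempty ∧ p (⋂ i ∈ I, L i), (-1 : ℤ) ^ (I.card + 1) := by
    intro p
    have : s.filter (fun i => p (F i)) =
        ((Finset.univ.filter fun I : Finset ι => I.Nonempty ∧ p (⋂ i ∈ I, K i))).disjSum
          (Finset.univ.filter fun I : Finset κ => I.Nonempty ∧ p (⋂ i ∈ I, L i)) := by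
      ext (I | I) <;> simp [hs, hF]
    rw [this, Finset.sum_disjSum]
    simp [hα, sub_eq_add_neg]
  have key := sum_nonempty_eq_zero_of_sum_mem_eq_zero s α n F ?_ ?_ ?_
  · rw [hsplit] at key
    exact sub_eq_zero.1 key
  · rintro (I | I) hI
    · exact isCompact_biInter_finset hKc (by simpa [hs] using hI)
    · exact isCompact_biInter_finset hLc (by simpa [hs] using hI)
  · rintro (I | I) hI
    · exact convex_iInter₂ fun i _ => hKv i
    · exact convex_iInter₂ fun i _ => hLv i
  · intro x
    rw [hsplit (fun S => x ∈ S)]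
    have h1 := sum_mem_biInter_neg_one_pow K x
    have h2 := sum_mem_biInter_neg_one_pow L x
    rw [h] at h1
    rw [h1, h2, sub_self]

/-! ### Convex polyhedra and piecewise linear maps -/

section PL

variable {E F G : Type*} [AddCommGroup E] [Module ℝ E] [AddCommGroup F] [Module ℝ F]
  [AddCommGroup G] [Module ℝ G]

theorem isConvexPolyhedron_of_finite {ι : Type*} [Finite ι] (l : ι → Module.Dual ℝ E) (b : ι → ℝ) :
    IsConvexPolyhedron {x | ∀ i, l i x ≤ b i} :=
  ⟨Set.range fun i => (l i, b i), Set.finite_range _, by ext x; simp⟩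

theorem isConvexPolyhedron_univ : IsConvexPolyhedron (Set.univ : Set E) :=
  ⟨∅, Set.finite_empty, by simp⟩

theorem IsConvexPolyhedron.inter {P Q : Set E} (hP : IsConvexPolyhedron P)
    (hQ : IsConvexPolyhedron Q) : IsConvexPolyhedron (P ∩ Q) := by
  obtain ⟨H, hH, rfl⟩ := hP
  obtain ⟨H', hH', rfl⟩ := hQ
  refine ⟨H ∪ H', hH.union hH', ?_⟩
  ext x
  constructor
  · rintro ⟨h1, h2⟩ h (h3 | h3)
    exacts [h1 h h3, h2 h h3]
  · exact fun h => ⟨fun k hk => h k (Or.inl hk), fun k hk => h k (Or.inr hk)⟩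

theorem IsConvexPolyhedron.preimage {P : Set F} (hP : IsConvexPolyhedron P) (A : E →ᵃ[ℝ] F) :
    IsConvexPolyhedron (A ⁻¹' P) := by
  obtain ⟨H, hH, rfl⟩ := hP
  refine ⟨(fun h => (h.1 ∘ₗ A.linear, h.2 - h.1 (A 0))) '' H, hH.image _, ?_⟩
  ext x
  have hA : A x = A.linear x + A 0 := by
    have := A.map_vadd 0 x
    simpa using this
  simp only [Set.mem_preimage, Set.mem_ofPred_eq, Set.forall_mem_image, LinearMap.comp_apply]
  refine forall₂_congr fun h _ => ?_
  rw [hA, map_add, le_sub_iff_add_le]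

theorem IsConvexPolyhedron.convex {P : Set E} (hP : IsConvexPolyhedron P) : Convex ℝ P := by
  obtain ⟨H, _, rfl⟩ := hP
  have : {x : E | ∀ h ∈ H, h.1 x ≤ h.2} = ⋂ h ∈ H, {x | h.1 x ≤ h.2} := by ext; simp
  rw [this]
  exact convex_iInter₂ fun h _ => convex_halfSpace_le h.1.isLinear _

theorem IsConvexPolyhedron.isClosed [TopologicalSpace E] [T2Space E] [IsTopologicalAddGroup E]
    [ContinuousSMul ℝ E] [FiniteDimensional ℝ E] {P : Set E} (hP : IsConvexPolyhedron P) :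
    IsClosed P := by
  obtain ⟨H, _, rfl⟩ := hP
  have : {x : E | ∀ h ∈ H, h.1 x ≤ h.2} = ⋂ h ∈ H, {x | h.1 x ≤ h.2} := by ext; simp
  rw [this]
  exact isClosed_biInter fun h _ =>
    isClosed_le (LinearMap.continuous_of_finiteDimensional _) continuous_const

theorem IsPLOn.of_pieces {ι : Type*} [Finite ι] {f : E → F} {S : Set E} (P : ι → Set E)
    (A : ι → E →ᵃ[ℝ] F) (hS : ∀ x ∈ S, ∃ i, x ∈ P i) (hP : ∀ i, IsConvexPolyhedron (P i))
    (hA : ∀ i, ∀ x ∈ S, x ∈ P i → f x = A i x) : IsPLOn f S := by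
  refine ⟨Set.range P, Set.finite_range P, fun x hx => ?_, ?_⟩
  · obtain ⟨i, hi⟩ := hS x hx
    exact ⟨_, ⟨i, rfl⟩, hi⟩
  · rintro _ ⟨i, rfl⟩
    exact ⟨hP i, A i, fun x hx => hA i x hx.1 hx.2⟩

theorem IsPLOn.exists_pieces {f : E → F} {S : Set E} (h : IsPLOn f S) :
    ∃ (Q : Set (Set E)) (A : Q → E →ᵃ[ℝ] F), Finite Q ∧ (∀ x ∈ S, ∃ i : Q, x ∈ i.1) ∧
      (∀ i : Q, IsConvexPolyhedron i.1) ∧ ∀ i : Q, ∀ x ∈ S, x ∈ i.1 → f x = A i x := by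
  obtain ⟨Q, hQ, hS, h⟩ := h
  choose hP A hA using h
  refine ⟨Q, fun i => A i.1 i.2, hQ, fun x hx => ?_, fun i => hP i.1 i.2, fun i x hx hi =>
    hA i.1 i.2 ⟨hx, hi⟩⟩
  obtain ⟨P, hP, hx⟩ := hS hx
  exact ⟨⟨P, hP⟩, hx⟩

theorem isPLOn_affine (A : E →ᵃ[ℝ] F) (S : Set E) : IsPLOn A S :=
  IsPLOn.of_pieces (ι := Unit) (fun _ => Set.univ) (fun _ => A) (fun _ _ => ⟨(), trivial⟩)
    (fun _ => isConvexPolyhedron_univ) fun _ _ _ _ => rfl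

theorem isPLOn_linear (A : E →ₗ[ℝ] F) (S : Set E) : IsPLOn A S :=
  isPLOn_affine A.toAffineMap S

theorem IsPLOn.comp {f : E → F} {g : F → G} {S : Set E} {T : Set F} (hg : IsPLOn g T)
    (hf : IsPLOn f S) (hST : Set.MapsTo f S T) : IsPLOn (g ∘ f) S := by
  obtain ⟨Q, A, hQ, hS, hP, hA⟩ := hf.exists_pieces
  obtain ⟨Q', A', hQ', hS', hP', hA'⟩ := hg.exists_pieces
  refine IsPLOn.of_pieces (ι := Q × Q') (fun i => i.1.1 ∩ A i.1 ⁻¹' i.2.1)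
    (fun i => (A' i.2).comp (A i.1)) (fun x hx => ?_) (fun i => (hP i.1).inter ((hP' i.2).preimage _))
    ?_
  · obtain ⟨i, hi⟩ := hS x hx
    obtain ⟨j, hj⟩ := hS' _ (hST hx)
    exact ⟨(i, j), hi, by simpa [← hA i x hx hi] using hj⟩
  · rintro ⟨i, j⟩ x hx ⟨h1, h2⟩
    have h3 := hA i x hx h1
    simp only [Set.mem_preimage, ← h3] at h2
    simp only [Function.comp_apply, AffineMap.comp_apply, ← h3]
    exact hA' j _ (hST hx) h2

theorem IsPLOn.prodMk {f : E → F} {g : E → G} {S : Set E} (hf : IsPLOn f S) (hg : IsPLOn g S) :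
    IsPLOn (fun x => (f x, g x)) S := by
  obtain ⟨Q, A, hQ, hS, hP, hA⟩ := hf.exists_pieces
  obtain ⟨Q', A', hQ', hS', hP', hA'⟩ := hg.exists_pieces
  refine IsPLOn.of_pieces (ι := Q × Q') (fun i => i.1.1 ∩ i.2.1)
    (fun i => (A i.1).prod (A' i.2)) (fun x hx => ?_) (fun i => (hP i.1).inter (hP' i.2)) ?_
  · obtain ⟨i, hi⟩ := hS x hx
    obtain ⟨j, hj⟩ := hS' _ hx
    exact ⟨(i, j), hi, hj⟩
  · rintro ⟨i, j⟩ x hx ⟨h1, h2⟩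
    simp [hA i x hx h1, hA' j x hx h2]

theorem IsPLOn.congr {f g : E → F} {S : Set E} (hf : IsPLOn f S) (h : Set.EqOn g f S) :
    IsPLOn g S := by
  obtain ⟨Q, A, hQ, hS, hP, hA⟩ := hf.exists_pieces
  exact IsPLOn.of_pieces (fun i : Q => i.1) A hS hP fun i x hx hi => (h hx).trans (hA i x hx hi)

end PL

/-! ### Piecewise linear homeomorphisms of realizations -/

section Space

variable {V W U : Type*} {K : PreAbstractSimplicialComplex V} {L : PreAbstractSimplicialComplex W}
  {N : PreAbstractSimplicialComplex U}

theorem PLHomeomorphic.symm (h : PLHomeomorphic K L) : PLHomeomorphic L K := by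
  obtain ⟨f, g, hf, hg, hi, pf, pg⟩ := h
  exact ⟨g, f, hg, hf, hi.symm, pg, pf⟩

theorem PLHomeomorphic.trans (h : PLHomeomorphic K L) (h' : PLHomeomorphic L N) :
    PLHomeomorphic K N := by
  obtain ⟨f, g, hf, hg, hi, pf, pg⟩ := h
  obtain ⟨f', g', hf', hg', hi', pf', pg'⟩ := h'
  exact ⟨f' ∘ f, g ∘ g', hf'.comp hf, hg.comp hg', hi.comp hi' hf hg', pf'.comp pf hf,
    pg.comp pg' hg'⟩

/-- The sum of the coordinates. -/
noncomputable def total (V : Type*) : (V →₀ ℝ) →ₗ[ℝ] ℝ := Finsupp.linearCombination ℝ fun _ => (1 : ℝ)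

theorem total_eq_sum {x : V →₀ ℝ} {s : Finset V} (h : x.support ⊆ s) :
    total V x = ∑ v ∈ s, x v := by
  unfold total
  rw [Finsupp.linearCombination_apply, Finsupp.sum_of_support_subset _ h] <;> simp

@[simp] theorem total_single (v : V) (a : ℝ) : total V (Finsupp.single v a) = a := by
  simp [total]

theorem total_nonneg {x : V →₀ ℝ} (h : ∀ v, 0 ≤ x v) : 0 ≤ total V x := by
  rw [total_eq_sum subset_rfl]
  exact Finset.sum_nonneg fun v _ => h v

theorem eq_zero_of_total_eq_zero {x : V →₀ ℝ} (h : ∀ v, 0 ≤ x v) (h0 : total V x = 0) : x = 0 := by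
  rw [total_eq_sum subset_rfl, Finset.sum_eq_zero_iff_of_nonneg fun v _ => h v] at h0
  ext v
  by_cases hv : v ∈ x.support
  · exact h0 v hv
  · simpa using hv

theorem total_ne_zero {x : V →₀ ℝ} (h : ∀ v, 0 ≤ x v) (h0 : x ≠ 0) : total V x ≠ 0 :=
  fun hx => h0 (eq_zero_of_total_eq_zero h hx)

theorem face_nonempty (K : PreAbstractSimplicialComplex V) {s : Finset V} (h : s ∈ K.faces) :
    s.Nonempty := (K.isRelLowerSet_faces h).1

theorem face_of_subset (K : PreAbstractSimplicialComplex V) {s t : Finset V} (h : s ∈ K.faces)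
    (hts : t ⊆ s) (ht : t.Nonempty) : t ∈ K.faces := (K.isRelLowerSet_faces h).2 hts ht

theorem vertex_mem (K : PreAbstractSimplicialComplex V) {s : Finset V} (h : s ∈ K.faces)
    {v : V} (hv : v ∈ s) : {v} ∈ K.faces :=
  face_of_subset K h (by simpa) (by simp)

theorem mem_geomSimplex {s : Finset V} {x : V →₀ ℝ} :
    x ∈ geomSimplex s ↔ (∀ v, 0 ≤ x v) ∧ x.support ⊆ s ∧ total V x = 1 :=
  and_congr_right fun _ => and_congr_right fun h => by rw [total_eq_sum h]

theorem mem_space {x : V →₀ ℝ} :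
    x ∈ space K.faces ↔ (∀ v, 0 ≤ x v) ∧ x.support ∈ K.faces ∧ total V x = 1 := by
  simp only [space, Set.mem_iUnion, mem_geomSimplex, exists_prop]
  constructor
  · rintro ⟨s, hs, h0, h1, h2⟩
    refine ⟨h0, face_of_subset K hs h1 ?_, h2⟩
    rw [Finsupp.support_nonempty_iff]
    rintro rfl
    simp at h2
  · rintro ⟨h0, h1, h2⟩
    exact ⟨_, h1, h0, subset_rfl, h2⟩

/-- The cone over `|K|`, with apex at the origin. -/
def cone (K : PreAbstractSimplicialComplex V) : Set (V →₀ ℝ) :=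
  {x | (∀ v, 0 ≤ x v) ∧ (x = 0 ∨ x.support ∈ K.faces)}

theorem mem_space_iff_cone {x : V →₀ ℝ} : x ∈ space K.faces ↔ x ∈ cone K ∧ total V x = 1 := by
  rw [mem_space]
  constructor
  · rintro ⟨h0, h1, h2⟩
    exact ⟨⟨h0, Or.inr h1⟩, h2⟩
  · rintro ⟨⟨h0, h1⟩, h2⟩
    refine ⟨h0, h1.resolve_left ?_, h2⟩
    rintro rfl
    simp at h2

theorem smul_mem_cone {x : V →₀ ℝ} (h : x ∈ cone K) {a : ℝ} (ha : 0 ≤ a) : a • x ∈ cone K := by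
  rcases ha.eq_or_lt with rfl | ha
  · simp [cone]
  · refine ⟨fun v => mul_nonneg ha.le (h.1 v), h.2.imp (by rintro rfl; simp) fun h => ?_⟩
    rwa [Finsupp.support_smul_eq ha.ne']

theorem normalize_mem_space {x : V →₀ ℝ} (h : x ∈ cone K) (h0 : x ≠ 0) :
    (total V x)⁻¹ • x ∈ space K.faces := by
  rw [mem_space_iff_cone]
  refine ⟨smul_mem_cone h (inv_nonneg.2 (total_nonneg h.1)), ?_⟩
  rw [map_smul, smul_eq_mul, inv_mul_cancel₀ (total_ne_zero h.1 h0)]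

/-- The homogeneous extension of a map from the realization of a complex to the cone over it. -/
noncomputable def coneMap (f : (V →₀ ℝ) → (W →₀ ℝ)) (x : V →₀ ℝ) : W →₀ ℝ :=
  total V x • f ((total V x)⁻¹ • x)

@[simp] theorem coneMap_zero (f : (V →₀ ℝ) → (W →₀ ℝ)) : coneMap f 0 = 0 := by
  simp [coneMap]

theorem coneMap_mem {f : (V →₀ ℝ) → (W →₀ ℝ)} (hf : Set.MapsTo f (space K.faces) (space L.faces))
    {x : V →₀ ℝ} (hx : x ∈ cone K) : coneMap f x ∈ cone L := by
  by_cases h0 : x = 0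
  · subst h0; simp [cone]
  · exact smul_mem_cone (mem_space_iff_cone.1 (hf (normalize_mem_space hx h0))).1
      (total_nonneg hx.1)

theorem total_coneMap {f : (V →₀ ℝ) → (W →₀ ℝ)}
    (hf : Set.MapsTo f (space K.faces) (space L.faces))
    {x : V →₀ ℝ} (hx : x ∈ cone K) : total W (coneMap f x) = total V x := by
  by_cases h0 : x = 0
  · subst h0; simp
  · rw [coneMap, map_smul, (mem_space_iff_cone.1 (hf (normalize_mem_space hx h0))).2, smul_eq_mul,
      mul_one]

theorem coneMap_leftInv {f : (V →₀ ℝ) → (W →₀ ℝ)} {g : (W →₀ ℝ) → (V →₀ ℝ)}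
    (hf : Set.MapsTo f (space K.faces) (space L.faces))
    (hi : Set.LeftInvOn g f (space K.faces)) {x : V →₀ ℝ} (hx : x ∈ cone K) :
    coneMap g (coneMap f x) = x := by
  by_cases h0 : x = 0
  · subst h0; simp
  · have ht := total_ne_zero hx.1 h0
    rw [coneMap, total_coneMap hf hx, coneMap, smul_smul, inv_mul_cancel₀ ht, one_smul,
      hi (normalize_mem_space hx h0), smul_smul, mul_inv_cancel₀ ht, one_smul]

theorem isPLOn_coneMap {f : (V →₀ ℝ) → (W →₀ ℝ)} (hf : IsPLOn f (space K.faces)) :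
    IsPLOn (coneMap f) (cone K) := by
  obtain ⟨Q, A, hQ, hS, hP, hA⟩ := hf.exists_pieces
  choose H hH hHP using hP
  by_cases hne : Nonempty Q
  · refine IsPLOn.of_pieces (ι := Q) (fun i => {x | ∀ h ∈ H i, h.1 x ≤ h.2 * total V x})
      (fun i => ((A i).linear + (total V).smulRight (A i 0)).toAffineMap) (fun x hx => ?_)
      (fun i => ?_) fun i x hx hxi => ?_
    · by_cases h0 : x = 0
      · exact ⟨hne.some, by simp [h0]⟩
      · obtain ⟨i, hi⟩ := hS _ (normalize_mem_space hx h0)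
        refine ⟨i, fun h hh => ?_⟩
        rw [hHP i] at hi
        have := hi h hh
        have ht : 0 < total V x := (total_nonneg hx.1).lt_of_ne' (total_ne_zero hx.1 h0)
        rw [map_smul, smul_eq_mul, inv_mul_le_iff₀ ht] at this
        linarith
    · refine ⟨(fun h => (h.1 - h.2 • total V, 0)) '' H i, (hH i).image _, ?_⟩
      ext x
      simp only [Set.mem_ofPred_eq, Set.forall_mem_image]
      exact forall₂_congr fun h _ => by simp
    · by_cases h0 : x = 0
      · simp [h0]
      · have ht : 0 < total V x := (total_nonneg hx.1).lt_of_ne' (total_ne_zero hx.1 h0)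
        have hAx : ∀ y, A i y = (A i).linear y + A i 0 := fun y => by
          simpa using (A i).map_vadd 0 y
        rw [coneMap, hA i _ (normalize_mem_space hx h0), hAx]
        · simp [smul_smul, mul_inv_cancel₀ ht.ne']
        · rw [hHP i]
          intro h hh
          rw [map_smul, smul_eq_mul, inv_mul_le_iff₀ ht]
          have := hxi h hh
          linarith
  · -- without pieces `|K|` is empty, so its cone is a point
    refine (isPLOn_affine (AffineMap.const ℝ _ 0) (cone K)).congr fun x hx => ?_
    by_cases h0 : x = 0
    · simp [h0]
    · exact absurd ⟨(hS _ (normalize_mem_space hx h0)).choose⟩ hne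

end Space

section LinearHomeo

variable {V W : Type*} {K : PreAbstractSimplicialComplex V} {L : PreAbstractSimplicialComplex W}

theorem total_apply_of_mapsTo {f : (V →₀ ℝ) →ₗ[ℝ] (W →₀ ℝ)}
    (hf : Set.MapsTo f (space K.faces) (space L.faces)) {x : V →₀ ℝ} (hx : x ∈ cone K) :
    total W (f x) = total V x := by
  by_cases h0 : x = 0
  · simp [h0]
  · have h1 := (mem_space_iff_cone.1 (hf (normalize_mem_space hx h0))).2
    rwa [map_smul, map_smul, smul_eq_mul, inv_mul_eq_one₀ (total_ne_zero hx.1 h0), eq_comm] at h1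

theorem injOn_cone_of_injOn_space {f : (V →₀ ℝ) →ₗ[ℝ] (W →₀ ℝ)}
    (hf : Set.MapsTo f (space K.faces) (space L.faces)) (hi : Set.InjOn f (space K.faces)) :
    Set.InjOn f (cone K) := by
  intro x hx y hy hxy
  have ht : total V x = total V y := by
    rw [← total_apply_of_mapsTo hf hx, ← total_apply_of_mapsTo hf hy, hxy]
  by_cases h0 : x = 0
  · rw [h0, map_zero] at ht
    rw [h0, eq_zero_of_total_eq_zero hy.1 ht.symm]
  · have h0' : y ≠ 0 := by
      rintro rfl
      exact total_ne_zero hx.1 h0 (by simpa using ht)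
    have h1 := hi (normalize_mem_space hx h0) (normalize_mem_space hy h0')
      (by rw [map_smul, map_smul, ht, hxy])
    rw [ht] at h1
    exact smul_right_injective _ (inv_ne_zero (total_ne_zero hy.1 h0')) h1

theorem exists_linear_leftInverse {f : (V →₀ ℝ) →ₗ[ℝ] (W →₀ ℝ)} (hi : Set.InjOn f (cone K))
    {s : Finset V} (hs : s ∈ K.faces) :
    ∃ g : (W →₀ ℝ) →ₗ[ℝ] (V →₀ ℝ), (∀ x : V →₀ ℝ, x.support ⊆ s → g (f x) = x) ∧
      ∀ y, (g y).support ⊆ s := by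
  have hsub : ∀ x : V →₀ ℝ, x.support ⊆ s → (∀ v, 0 ≤ x v) → x ∈ cone K := by
    intro x hx h0
    refine ⟨h0, or_iff_not_imp_left.2 fun hne => face_of_subset K hs hx ?_⟩
    rwa [Finsupp.support_nonempty_iff]
  have hker : LinearMap.ker (f.domRestrict (Finsupp.supported ℝ ℝ (s : Set V))) = ⊥ := by
    rw [LinearMap.ker_eq_bot']
    rintro ⟨x, hx⟩ h
    have hx' : x.support ⊆ s := by simpa [Finsupp.mem_supported] using hx
    -- compare the positive and the negative part of `x`
    let p : V →₀ ℝ := x.mapRange (fun a => max a 0) (by simp)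
    let q : V →₀ ℝ := x.mapRange (fun a => max (-a) 0) (by simp)
    have hpq : x = p - q := by
      ext v
      simp only [p, q, Finsupp.sub_apply, Finsupp.mapRange_apply]
      rcases le_total (x v) 0 with h | h <;> simp [h]
    have h2 : p = q := by
      refine hi (hsub p ?_ fun v => le_max_right _ _) (hsub q ?_ fun v => le_max_right _ _) ?_
      · exact Finsupp.support_mapRange.trans hx'
      · exact Finsupp.support_mapRange.trans hx'
      · rw [← sub_eq_zero, ← map_sub, ← hpq]
        exact h
    simp [hpq, h2]
  obtain ⟨g, hg⟩ := LinearMap.exists_leftInverse_of_injective (K := ℝ)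
    (V := Finsupp.supported ℝ ℝ (s : Set V)) (V' := W →₀ ℝ) (f.domRestrict _) hker
  refine ⟨(Submodule.subtype _) ∘ₗ g, fun x hx => ?_, fun y => ?_⟩
  · have := LinearMap.congr_fun hg ⟨x, by simpa [Finsupp.mem_supported] using hx⟩
    simpa using congrArg Subtype.val this
  · exact_mod_cast (Finsupp.mem_supported ℝ _).1 (g y).2

/-- A linear map which restricts to a bijection of the realizations of two complexes, the first one
finite, is a PL homeomorphism: on the image of a simplex its inverse is the restriction of
a linear map. -/
theorem plHomeomorphic_of_linear (hK : K.faces.Finite) (f : (V →₀ ℝ) →ₗ[ℝ] (W →₀ ℝ))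
    (hf : Set.MapsTo f (space K.faces) (space L.faces)) (hi : Set.InjOn f (space K.faces))
    (hs : Set.SurjOn f (space K.faces) (space L.faces)) : PLHomeomorphic K L := by
  classical
  have hic := injOn_cone_of_injOn_space hf hi
  set g : (W →₀ ℝ) → (V →₀ ℝ) := Function.invFunOn f (space K.faces) with hg
  have hgm : Set.MapsTo g (space L.faces) (space K.faces) := fun y hy =>
    Function.invFunOn_mem (hs hy)
  have hgr : Set.RightInvOn g f (space L.faces) := fun y hy => Function.invFunOn_eq (hs hy)
  have hgl : Set.LeftInvOn g f (space K.faces) := fun x hx =>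
    hi (hgm (hf hx)) hx (hgr (hf hx))
  refine ⟨f, g, hf, hgm, ⟨hgl, hgr⟩, isPLOn_linear f _, ?_⟩
  have : Finite K.faces := hK
  choose G hG hGs using fun s : K.faces => exists_linear_leftInverse hic s.2
  -- all simplices of `|L|` that are met live on the finite set `T` of vertices
  let R : Finset V := hK.toFinset.biUnion id
  let T : Finset W := R.biUnion fun v => (f (Finsupp.single v 1)).support
  have hT : ∀ x : V →₀ ℝ, x.support ⊆ R → ∀ w ∉ T, f x w = 0 := by
    intro x hx w hw
    have h1 : x = ∑ v ∈ R, x v • Finsupp.single v (1 : ℝ) := by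
      conv_lhs => rw [← Finsupp.sum_single x, Finsupp.sum_of_support_subset x hx _ (by simp)]
      exact Finset.sum_congr rfl fun v _ => by simp
    rw [h1, map_sum, Finsupp.finsetSum_apply]
    refine Finset.sum_eq_zero fun v hv => ?_
    have h2 : f (Finsupp.single v 1) w = 0 :=
      Finsupp.notMem_support_iff.1 fun h => hw (Finset.mem_biUnion.2 ⟨v, hv, h⟩)
    rw [map_smul, Finsupp.smul_apply, h2, smul_zero]
  have hR : ∀ s ∈ K.faces, s ⊆ R := fun s hs => Finset.subset_biUnion_of_mem id
    (hK.mem_toFinset.2 hs)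
  refine IsPLOn.of_pieces (ι := K.faces)
    (fun s => {y | (∀ v : s.1, (-(Finsupp.lapply v.1 ∘ₗ G s) : Module.Dual ℝ (W →₀ ℝ)) y ≤ 0)} ∩
      ({y | ∀ w : T, (Finsupp.lapply w.1 ∘ₗ (LinearMap.id - f ∘ₗ G s) :
        Module.Dual ℝ (W →₀ ℝ)) y ≤ 0} ∩
      {y | ∀ w : T, (-(Finsupp.lapply w.1 ∘ₗ (LinearMap.id - f ∘ₗ G s)) :
        Module.Dual ℝ (W →₀ ℝ)) y ≤ 0}))
    (fun s => (G s).toAffineMap) (fun y hy => ?_) (fun s => ?_) fun s y hy hys => ?_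
  · obtain ⟨x, hx, rfl⟩ := hs hy
    have hx' := mem_space.1 hx
    refine ⟨⟨x.support, hx'.2.1⟩, ?_⟩
    simp [hG ⟨x.support, hx'.2.1⟩ x subset_rfl, hx'.1]
  · exact (isConvexPolyhedron_of_finite _ _).inter
      ((isConvexPolyhedron_of_finite _ _).inter (isConvexPolyhedron_of_finite _ _))
  · simp only [Set.mem_inter_iff, Set.mem_ofPred_eq, LinearMap.neg_apply, LinearMap.comp_apply,
      Finsupp.lapply_apply, LinearMap.sub_apply, LinearMap.id_apply, Finsupp.sub_apply] at hys
    obtain ⟨h1, h2, h3⟩ := hys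
    obtain ⟨x, hx, rfl⟩ := hs hy
    have hx' := mem_space.1 hx
    have hfG : f x = f (G s (f x)) := by
      ext w
      by_cases hw : w ∈ T
      · have := h2 ⟨w, hw⟩
        have := h3 ⟨w, hw⟩
        simp only at *
        linarith
      · rw [hT x (hR _ hx'.2.1) w hw, hT _ ((hGs s _).trans (hR _ s.2)) w hw]
    have h0 : ∀ v, 0 ≤ G s (f x) v := by
      intro v
      by_cases hv : v ∈ s.1
      · simpa using h1 ⟨v, hv⟩
      · rw [Finsupp.notMem_support_iff.1 fun h => hv (hGs s _ h)]
    rw [hgl hx, LinearMap.coe_toAffineMap]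
    refine hic (mem_space_iff_cone.1 hx).1 ⟨h0, or_iff_not_imp_left.2 fun hne => ?_⟩ hfG
    exact face_of_subset K s.2 (hGs s _) (Finsupp.support_nonempty_iff.2 hne)

/-- A complex PL-homeomorphic to a complex on finitely many vertices is finite. -/
theorem PLHomeomorphic.finite [Fintype W] (h : PLHomeomorphic K L) : K.faces.Finite := by
  classical
  obtain ⟨f, g, hf, hg, hi, pf, pg⟩ := h
  obtain ⟨Q, A, hQ, hS, hP, hA⟩ := pg.exists_pieces
  have := Fintype.ofFinite Q
  let T : Finset V := Finset.univ.biUnion fun i : Q =>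
    (A i 0).support ∪ Finset.univ.biUnion fun w : W => ((A i).linear (Finsupp.single w 1)).support
  have hT : ∀ y ∈ space L.faces, (g y).support ⊆ T := by
    intro y hy v hv
    obtain ⟨i, hi⟩ := hS y hy
    have hAx : A i y = (A i).linear y + A i 0 := by simpa using (A i).map_vadd 0 y
    have h1 : y = ∑ w, y w • Finsupp.single w (1 : ℝ) := by
      conv_lhs => rw [← Finsupp.univ_sum_single y]
      simp
    rw [hA i y hy hi, hAx, h1, map_sum] at hv
    by_contra hvT
    simp only [T, Finset.mem_biUnion, Finset.mem_univ, true_and, Finset.mem_union, not_exists,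
      not_or, Finsupp.mem_support_iff, not_not] at hvT
    rw [Finsupp.mem_support_iff] at hv
    refine hv ?_
    rw [Finsupp.add_apply, (hvT i).1, add_zero, Finsupp.finsetSum_apply]
    refine Finset.sum_eq_zero fun w _ => ?_
    rw [map_smul, Finsupp.smul_apply, (hvT i).2 w, smul_zero]
  refine T.powerset.finite_toSet.subset ?_
  intro s hs
  rw [Finset.mem_coe, Finset.mem_powerset]
  intro v hv
  have hx : Finsupp.single v (1 : ℝ) ∈ space K.faces := by
    rw [mem_space]
    refine ⟨fun w => ?_, ?_, by simp⟩
    · by_cases h : v = w <;> simp [h]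
    · rw [Finsupp.support_single _ one_ne_zero]
      exact vertex_mem K hs hv
  have := hT _ (hf hx)
  rw [hi.1 hx, Finsupp.support_single _ one_ne_zero] at this
  simpa using this

end LinearHomeo

/-! ### Spheres are not disks -/

theorem nerveEuler_image {ι E F : Type*} [Fintype ι] {K : ι → Set E} {f : E → F}
    (hf : Set.InjOn f (⋃ i, K i)) : nerveEuler (fun i => f '' K i) = nerveEuler K := by
  classical
  unfold nerveEuler
  refine Finset.sum_congr ?_ fun _ _ => rfl
  ext I
  simp only [Finset.mem_filter, Finset.mem_univ, true_and, and_congr_right_iff]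
  intro hI
  obtain ⟨i, hi⟩ := hI
  constructor
  · rintro ⟨y, hy⟩
    simp only [Set.mem_iInter] at hy
    obtain ⟨x, hx, rfl⟩ := hy i hi
    refine ⟨x, Set.mem_iInter₂.2 fun j hj => ?_⟩
    obtain ⟨x', hx', h⟩ := hy j hj
    rwa [← hf (Set.mem_iUnion_of_mem _ hx') (Set.mem_iUnion_of_mem _ hx) h]
  · rintro ⟨x, hx⟩
    simp only [Set.mem_iInter] at hx
    exact ⟨f x, Set.mem_iInter₂.2 fun j hj => ⟨x, hx j hj, rfl⟩⟩

/-- The facets of a simplex cover its boundary, and their nerve is the boundary of a simplex. -/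
theorem nerveEuler_facets_ne_one (n : ℕ) :
    nerveEuler (fun j : Fin (n + 1) => {x | x ∈ stdSimplex ℝ (Fin (n + 1)) ∧ x j = 0}) ≠ 1 := by
  classical
  have h := sum_nonempty_neg_one_pow (Finset.univ : Finset (Fin (n + 1)))
  rw [if_pos Finset.univ_nonempty] at h
  have h2 : (Finset.univ.filter fun I : Finset (Fin (n + 1)) => I.Nonempty ∧
      (⋂ i ∈ I, {x | x ∈ stdSimplex ℝ (Fin (n + 1)) ∧ x i = 0}).Nonempty) =
      (Finset.univ.filter fun I : Finset (Fin (n + 1)) => I.Nonempty ∧ I ⊆ Finset.univ).erase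
        Finset.univ := by
    ext I
    simp only [Finset.mem_filter, Finset.mem_univ, true_and, Finset.mem_erase, Finset.subset_univ,
      and_true, and_comm (b := I.Nonempty), and_congr_right_iff]
    rintro ⟨i, hi⟩
    constructor
    · rintro ⟨x, hx⟩ rfl
      simp only [Set.mem_iInter] at hx
      have h1 := (hx i hi).1.2
      rw [Finset.sum_eq_zero fun j _ => (hx j (Finset.mem_univ j)).2] at h1
      exact zero_ne_one h1
    · intro hI
      obtain ⟨j, hj⟩ : ∃ j, j ∉ I := by
        by_contra! hc
        exact hI (Finset.eq_univ_iff_forall.2 hc)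
      refine ⟨Pi.single j 1, Set.mem_iInter₂.2 fun i hi => ⟨single_mem_stdSimplex ℝ j, ?_⟩⟩
      exact Pi.single_eq_of_ne (fun h : i = j => hj (h ▸ hi)) _
  unfold nerveEuler
  rw [h2]
  have h3 := Finset.add_sum_erase (Finset.univ.filter fun I : Finset (Fin (n + 1)) =>
    I.Nonempty ∧ I ⊆ Finset.univ) (fun I => (-1 : ℤ) ^ (I.card + 1))
    (Finset.mem_filter.2 ⟨Finset.mem_univ Finset.univ, Finset.univ_nonempty, subset_rfl⟩)
  intro h4
  rw [h4] at h3
  have h5 := h3.trans (by convert h)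
  have : (-1 : ℤ) ^ ((Finset.univ : Finset (Fin (n + 1))).card + 1) = 0 := by linarith
  exact pow_ne_zero _ (by norm_num) this

/-- The boundary of a simplex is not PL-homeomorphic to a simplex: by additivity a PL homeomorphism
preserves the Euler characteristic, which is `1` for a simplex and `0` or `2` for its boundary. -/
theorem not_plHomeomorphic_simplexBoundary_simplex (a n : ℕ) :
    ¬ PLHomeomorphic (simplexBoundary a) (simplex n) := by
  classical
  rintro ⟨f, g, hf, hg, hi, pf, -⟩
  obtain ⟨Q, A, hQ, hS, hP, hA⟩ := pf.exists_pieces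
  have := Fintype.ofFinite Q
  let e := Finsupp.linearEquivFunOnFinite ℝ ℝ (Fin (a + 1))
  let e' := Finsupp.linearEquivFunOnFinite ℝ ℝ (Fin (n + 1))
  have hspace' : ∀ y, y ∈ space (simplex n).faces ↔ e' y ∈ stdSimplex ℝ (Fin (n + 1)) := by
    intro y
    rw [mem_space, total_eq_sum (Finset.subset_univ _)]
    refine and_congr_right fun _ => ⟨fun h => h.2, fun h => ⟨?_, h⟩⟩
    change y.support.Nonempty
    rw [Finsupp.support_nonempty_iff]
    rintro rfl
    simp [e'] at h
  have hspace : ∀ x, x ∈ space (simplexBoundary a).faces ↔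
      ∃ j, e x ∈ stdSimplex ℝ (Fin (a + 1)) ∧ e x j = 0 := by
    intro x
    rw [mem_space, total_eq_sum (Finset.subset_univ _)]
    constructor
    · rintro ⟨h0, h1, h2⟩
      obtain ⟨j, hj⟩ : ∃ j, j ∉ x.support := by
        by_contra! hc
        exact h1.2 (Finset.eq_univ_iff_forall.2 hc)
      exact ⟨j, ⟨h0, h2⟩, Finsupp.notMem_support_iff.1 hj⟩
    · rintro ⟨j, ⟨h0, h2⟩, hj⟩
      refine ⟨h0, ⟨?_, fun h => ?_⟩, h2⟩
      · rw [Finsupp.support_nonempty_iff]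
        rintro rfl
        simp [e] at h2
      · exact Finsupp.notMem_support_iff.2 hj (h ▸ Finset.mem_univ j)
  let S : Fin (a + 1) → Set (Fin (a + 1) → ℝ) :=
    fun j => {x | x ∈ stdSimplex ℝ (Fin (a + 1)) ∧ x j = 0}
  have hSc : ∀ j, IsCompact (S j) := fun j =>
    (isCompact_stdSimplex ℝ _).inter_right (isClosed_eq (continuous_apply j) continuous_const)
  have hSv : ∀ j, Convex ℝ (S j) := fun j =>
    (convex_stdSimplex ℝ _).inter (convex_hyperplane (LinearMap.proj j).isLinear 0)
  let C : Fin (a + 1) × Q → Set (Fin (a + 1) → ℝ) :=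
    fun i => S i.1 ∩ e.symm.toLinearMap.toAffineMap ⁻¹' i.2.1
  have hCc : ∀ i, IsCompact (C i) := fun i =>
    (hSc i.1).inter_right ((hP i.2).preimage _).isClosed
  have hCv : ∀ i, Convex ℝ (C i) := fun i => (hSv i.1).inter ((hP i.2).preimage _).convex
  have hCS : ⋃ i, C i = ⋃ j, S j := by
    ext x
    simp only [Set.mem_iUnion]
    constructor
    · rintro ⟨i, hi, -⟩
      exact ⟨_, hi⟩
    · rintro ⟨j, hj⟩
      obtain ⟨i, hi⟩ := hS (e.symm x) ((hspace _).2 ⟨j, by simpa [S] using hj⟩)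
      exact ⟨(j, i), hj, hi⟩
  have hmemS : ∀ x, x ∈ ⋃ j, S j ↔ e.symm x ∈ space (simplexBoundary a).faces := by
    intro x
    rw [hspace]
    simp [S]
  let F : (Fin (a + 1) → ℝ) → (Fin (n + 1) → ℝ) := fun x => e' (f (e.symm x))
  have hF : ∀ i, F '' C i = ((e'.toLinearMap.toAffineMap.comp (A i.2)).comp
      e.symm.toLinearMap.toAffineMap) '' C i := by
    intro i
    refine Set.image_congr fun x hx => ?_
    change e' (f (e.symm x)) = e' (A i.2 (e.symm x))
    rw [hA i.2 _ ((hmemS x).1 (hCS ▸ Set.mem_iUnion_of_mem i hx)) hx.2]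
  have hFi : Set.InjOn F (⋃ i, C i) := by
    rw [hCS]
    intro x hx y hy hxy
    exact e.symm.injective (hi.1.injOn ((hmemS x).1 hx) ((hmemS y).1 hy) (e'.injective hxy))
  have hU : ⋃ i, F '' C i = ⋃ _ : Unit, stdSimplex ℝ (Fin (n + 1)) := by
    rw [← Set.image_iUnion, hCS, Set.iUnion_const]
    ext y
    constructor
    · rintro ⟨x, hx, rfl⟩
      exact (hspace' _).1 (hf ((hmemS x).1 hx))
    · intro hy
      have hy' : e'.symm y ∈ space (simplex n).faces := (hspace' _).2 (by simpa using hy)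
      refine ⟨e (g (e'.symm y)), (hmemS _).2 (by simpa using hg hy'), ?_⟩
      simp [F, hi.2 hy']
  have h1 := nerveEuler_eq_of_iUnion_eq C S hCc hCv hSc hSv hCS
  have h2 := nerveEuler_eq_of_iUnion_eq (fun i => F '' C i)
    (fun _ : Unit => stdSimplex ℝ (Fin (n + 1)))
    (fun i => by
      rw [hF]
      exact (hCc i).image (AffineMap.continuous_of_finiteDimensional _))
    (fun i => by
      rw [hF]
      exact (hCv i).affine_image _)
    (fun _ => isCompact_stdSimplex ℝ _) (fun _ => convex_stdSimplex ℝ _) hU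
  rw [nerveEuler_image hFi, h1] at h2
  refine nerveEuler_facets_ne_one a (h2.trans ?_)
  have h3 : (Finset.univ.filter fun I : Finset Unit => I.Nonempty ∧
      (⋂ _ ∈ I, stdSimplex ℝ (Fin (n + 1))).Nonempty) = {{()}} := by
    ext I
    simp only [Finset.mem_filter, Finset.mem_univ, true_and, Finset.mem_singleton]
    constructor
    · rintro ⟨⟨i, hi⟩, -⟩
      ext j
      simp [show j = i from rfl, hi]
    · rintro rfl
      exact ⟨by simp, ⟨Pi.single 0 1, by simpa using single_mem_stdSimplex ℝ (0 : Fin (n + 1))⟩⟩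
  unfold nerveEuler
  rw [h3]
  simp

/-! ### Isomorphisms, links and joins of complexes -/

section Complexes

variable {V W V' W' : Type*} {K : PreAbstractSimplicialComplex V}
  {L : PreAbstractSimplicialComplex W} {K' : PreAbstractSimplicialComplex V'}
  {L' : PreAbstractSimplicialComplex W'}

open Classical in
/-- Isomorphism of simplicial complexes. The two maps are defined on all of the vertex types, but
they are only required to be mutually inverse on the vertices of the complexes. -/
def Iso (K : PreAbstractSimplicialComplex V) (L : PreAbstractSimplicialComplex W) : Prop :=
  ∃ (φ : V → W) (ψ : W → V), (∀ s ∈ K.faces, s.image φ ∈ L.faces) ∧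
    (∀ t ∈ L.faces, t.image ψ ∈ K.faces) ∧ (∀ v, {v} ∈ K.faces → ψ (φ v) = v) ∧
    ∀ w, {w} ∈ L.faces → φ (ψ w) = w

theorem iso_iff [DecidableEq V] [DecidableEq W] : Iso K L ↔
    ∃ (φ : V → W) (ψ : W → V), (∀ s ∈ K.faces, s.image φ ∈ L.faces) ∧
    (∀ t ∈ L.faces, t.image ψ ∈ K.faces) ∧ (∀ v, {v} ∈ K.faces → ψ (φ v) = v) ∧
    ∀ w, {w} ∈ L.faces → φ (ψ w) = w := by
  unfold Iso
  convert Iff.rfl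

theorem Iso.symm (h : Iso K L) : Iso L K := by
  obtain ⟨φ, ψ, h1, h2, h3, h4⟩ := h
  exact ⟨ψ, φ, h2, h1, h4, h3⟩

theorem Iso.trans (h : Iso K L) (h' : Iso L K') : Iso K K' := by
  classical
  obtain ⟨φ, ψ, h1, h2, h3, h4⟩ := iso_iff.1 h
  obtain ⟨φ', ψ', h1', h2', h3', h4'⟩ := iso_iff.1 h'
  refine iso_iff.2 ⟨φ' ∘ φ, ψ ∘ ψ', fun s hs => ?_, fun s hs => ?_, fun v hv => ?_, fun v hv => ?_⟩
  · rw [← Finset.image_image]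
    exact h1' _ (h1 _ hs)
  · rw [← Finset.image_image]
    exact h2 _ (h2' _ hs)
  · have := h1 _ hv
    rw [Finset.image_singleton] at this
    simp [h3' _ this, h3 _ hv]
  · have := h2' _ hv
    rw [Finset.image_singleton] at this
    simp [h4 _ this, h4' _ hv]

theorem mapsTo_mapDomain {φ : V → W} [DecidableEq W] (h : ∀ s ∈ K.faces, s.image φ ∈ L.faces) :
    Set.MapsTo (Finsupp.lmapDomain ℝ ℝ φ) (space K.faces) (space L.faces) := by
  intro x hx
  obtain ⟨h0, h1, h2⟩ := mem_space.1 hx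
  have ht : total W (Finsupp.lmapDomain ℝ ℝ φ x) = 1 := by
    rw [← h2, Finsupp.lmapDomain_apply, total, Finsupp.linearCombination_mapDomain]
    rfl
  rw [mem_space]
  refine ⟨fun w => ?_, face_of_subset L (h _ h1) Finsupp.mapDomain_support ?_, ht⟩
  · rw [Finsupp.lmapDomain_apply, Finsupp.mapDomain, Finsupp.sum, Finsupp.finsetSum_apply]
    refine Finset.sum_nonneg fun v _ => ?_
    rw [Finsupp.single_apply]
    split_ifs
    exacts [h0 v, le_rfl]
  · rw [Finsupp.support_nonempty_iff]
    intro h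
    rw [h] at ht
    simp at ht

theorem leftInvOn_lmapDomain {φ : V → W} {ψ : W → V} (h : ∀ v, {v} ∈ K.faces → ψ (φ v) = v) :
    Set.LeftInvOn (Finsupp.lmapDomain ℝ ℝ ψ) (Finsupp.lmapDomain ℝ ℝ φ) (space K.faces) := by
  intro x hx
  rw [Finsupp.lmapDomain_apply, Finsupp.lmapDomain_apply, ← Finsupp.mapDomain_comp]
  conv_rhs => rw [← Finsupp.mapDomain_id (v := x)]
  exact Finsupp.mapDomain_congr fun v hv => h v (vertex_mem K (mem_space.1 hx).2.1 hv)

theorem Iso.plHomeomorphic (h : Iso K L) : PLHomeomorphic K L := by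
  classical
  obtain ⟨φ, ψ, h1, h2, h3, h4⟩ := iso_iff.1 h
  exact ⟨Finsupp.lmapDomain ℝ ℝ φ, Finsupp.lmapDomain ℝ ℝ ψ, mapsTo_mapDomain h1,
    mapsTo_mapDomain h2, ⟨leftInvOn_lmapDomain h3, leftInvOn_lmapDomain h4⟩,
    isPLOn_linear _ _, isPLOn_linear _ _⟩

theorem mem_link [DecidableEq V] {s t : Finset V} :
    t ∈ (link K s).faces ↔ t.Nonempty ∧ Disjoint t s ∧ t ∪ s ∈ K.faces := by
  unfold link
  simp only [Set.mem_ofPred_eq]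
  convert Iff.rfl

theorem mem_link_singleton [DecidableEq V] {v : V} {t : Finset V} :
    t ∈ (link K {v}).faces ↔ t.Nonempty ∧ v ∉ t ∧ insert v t ∈ K.faces := by
  rw [mem_link, Finset.disjoint_singleton_right, Finset.union_comm, Finset.insert_eq]

theorem Iso.exists_link (h : Iso K L) {w : W} (hw : {w} ∈ L.faces) :
    ∃ v, {v} ∈ K.faces ∧ Iso (link K {v}) (link L {w}) := by
  classical
  obtain ⟨φ, ψ, h1, h2, h3, h4⟩ := iso_iff.1 h
  have hv : {ψ w} ∈ K.faces := by simpa using h2 _ hw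
  refine ⟨ψ w, hv, iso_iff.2 ⟨φ, ψ, fun s hs => ?_, fun t ht => ?_, fun v hv => ?_, fun v hv => ?_⟩⟩
  · rw [mem_link_singleton] at hs ⊢
    obtain ⟨hs1, hs2, hs3⟩ := hs
    refine ⟨hs1.image _, fun hc => ?_, ?_⟩
    · obtain ⟨v, hvs, rfl⟩ := Finset.mem_image.1 hc
      rw [h3 v (vertex_mem K hs3 (Finset.mem_insert_of_mem hvs))] at hs2
      exact hs2 hvs
    · have := h1 _ hs3
      rwa [Finset.image_insert, h4 w hw] at this
  · rw [mem_link_singleton] at ht ⊢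
    obtain ⟨ht1, ht2, ht3⟩ := ht
    refine ⟨ht1.image _, fun hc => ?_, ?_⟩
    · obtain ⟨v, hv, hvw⟩ := Finset.mem_image.1 hc
      have := h4 v (vertex_mem L ht3 (Finset.mem_insert_of_mem hv))
      rw [hvw, h4 w hw] at this
      exact ht2 (this ▸ hv)
    · have := h2 _ ht3
      rwa [Finset.image_insert] at this
  · rw [mem_link_singleton] at hv
    exact h3 v (vertex_mem K hv.2.2 (by simp))
  · rw [mem_link_singleton] at hv
    exact h4 v (vertex_mem L hv.2.2 (by simp))

/-- The join of two complexes, on the disjoint union of the vertices. -/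
def join (K : PreAbstractSimplicialComplex V) (L : PreAbstractSimplicialComplex W) :
    PreAbstractSimplicialComplex (V ⊕ W) where
  faces := {s | s.Nonempty ∧ (s.toLeft = ∅ ∨ s.toLeft ∈ K.faces) ∧
    (s.toRight = ∅ ∨ s.toRight ∈ L.faces)}
  isRelLowerSet_faces := by
    rintro s ⟨hs, h1, h2⟩
    refine ⟨hs, fun t hts ht => ⟨ht, ?_, ?_⟩⟩
    · rw [or_iff_not_imp_left, ← Finset.not_nonempty_iff_eq_empty, not_not]
      intro hne
      have hsub := Finset.toLeft_subset_toLeft hts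
      exact face_of_subset K (h1.resolve_left (hne.mono hsub).ne_empty) hsub hne
    · rw [or_iff_not_imp_left, ← Finset.not_nonempty_iff_eq_empty, not_not]
      intro hne
      have hsub := Finset.toRight_subset_toRight hts
      exact face_of_subset L (h2.resolve_left (hne.mono hsub).ne_empty) hsub hne

theorem mem_join {s : Finset (V ⊕ W)} : s ∈ (join K L).faces ↔ s.Nonempty ∧
    (s.toLeft = ∅ ∨ s.toLeft ∈ K.faces) ∧ (s.toRight = ∅ ∨ s.toRight ∈ L.faces) := Iff.rfl

@[simp] theorem toLeft_singleton_inl (v : V) : ({Sum.inl v} : Finset (V ⊕ W)).toLeft = {v} := by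
  ext; simp

@[simp] theorem toRight_singleton_inl (v : V) : ({Sum.inl v} : Finset (V ⊕ W)).toRight = ∅ := by
  ext; simp

@[simp] theorem toLeft_singleton_inr (w : W) : ({Sum.inr w} : Finset (V ⊕ W)).toLeft = ∅ := by
  ext; simp

@[simp] theorem toRight_singleton_inr (w : W) : ({Sum.inr w} : Finset (V ⊕ W)).toRight = {w} := by
  ext; simp

@[simp] theorem singleton_inl_mem_join {v : V} : {Sum.inl v} ∈ (join K L).faces ↔ {v} ∈ K.faces := by
  simp [mem_join]

@[simp] theorem singleton_inr_mem_join {w : W} : {Sum.inr w} ∈ (join K L).faces ↔ {w} ∈ L.faces := by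
  simp [mem_join]

theorem link_join_inl {v : V} (hv : {v} ∈ K.faces) :
    link (join K L) {Sum.inl v} = join (link K {v}) L := by
  classical
  ext s
  rw [mem_link_singleton, mem_join, mem_join, mem_link_singleton]
  simp only [Finset.toLeft_insert_inl, Finset.toRight_insert_inl, Finset.insert_ne_empty, false_or,
    Finset.insert_nonempty, true_and]
  refine and_congr_right fun _ => ?_
  rw [← and_assoc]
  refine and_congr_left fun _ => ?_
  rcases s.toLeft.eq_empty_or_nonempty with h | h
  · have : Sum.inl v ∉ s := by rw [← Finset.mem_toLeft, h]; simp
    simp [h, hv, this]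
  · simp [h, h.ne_empty]

theorem join_comm_iso (K : PreAbstractSimplicialComplex V) (L : PreAbstractSimplicialComplex W) :
    Iso (join K L) (join L K) := by
  classical
  refine iso_iff.2 ⟨Sum.swap, Sum.swap, ?_, ?_, by simp, by simp⟩
  all_goals
    intro s hs
    rw [mem_join] at hs ⊢
    rw [Finset.toLeft_image_swap, Finset.toRight_image_swap]
    exact ⟨hs.1.image _, hs.2.2, hs.2.1⟩

theorem link_join_inr {w : W} (hw : {w} ∈ L.faces) :
    link (join K L) {Sum.inr w} = join K (link L {w}) := by
  classical
  ext s
  rw [mem_link_singleton, mem_join, mem_join, mem_link_singleton]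
  simp only [Finset.toLeft_insert_inr, Finset.toRight_insert_inr, Finset.insert_ne_empty, false_or,
    Finset.insert_nonempty, true_and]
  refine and_congr_right fun _ => ?_
  rw [and_left_comm]
  refine and_congr_right fun _ => ?_
  rcases s.toRight.eq_empty_or_nonempty with h | h
  · have : Sum.inr w ∉ s := by rw [← Finset.mem_toRight, h]; simp
    simp [h, hw, this]
  · simp [h, h.ne_empty]

theorem image_map_mem_join [DecidableEq V'] [DecidableEq W'] {φ : V → V'} {φ' : W → W'}
    (h : ∀ s ∈ K.faces, s.image φ ∈ K'.faces) (h' : ∀ s ∈ L.faces, s.image φ' ∈ L'.faces)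
    {s : Finset (V ⊕ W)} (hs : s ∈ (join K L).faces) :
    s.image (Sum.map φ φ') ∈ (join K' L').faces := by
  have hl : (s.image (Sum.map φ φ')).toLeft = s.toLeft.image φ := by ext; simp
  have hr : (s.image (Sum.map φ φ')).toRight = s.toRight.image φ' := by ext; simp
  rw [mem_join] at hs ⊢
  rw [hl, hr, Finset.image_eq_empty, Finset.image_eq_empty]
  exact ⟨hs.1.image _, hs.2.1.imp_right (h _), hs.2.2.imp_right (h' _)⟩

theorem Iso.join (h : Iso K K') (h' : Iso L L') : Iso (join K L) (join K' L') := by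
  classical
  obtain ⟨φ, ψ, h1, h2, h3, h4⟩ := iso_iff.1 h
  obtain ⟨φ', ψ', h1', h2', h3', h4'⟩ := iso_iff.1 h'
  refine iso_iff.2 ⟨Sum.map φ φ', Sum.map ψ ψ', fun s hs => image_map_mem_join h1 h1' hs,
    fun s hs => image_map_mem_join h2 h2' hs, ?_, ?_⟩
  · rintro (v | v) hv
    · simpa using h3 v (by simpa using hv)
    · simpa using h3' v (by simpa using hv)
  · rintro (v | v) hv
    · simpa using h4 v (by simpa using hv)
    · simpa using h4' v (by simpa using hv)

theorem mem_space_join {x : V ⊕ W →₀ ℝ} : x ∈ space (join K L).faces ↔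
    (Finsupp.sumFinsuppLEquivProdFinsupp ℝ x).1 ∈ cone K ∧
    (Finsupp.sumFinsuppLEquivProdFinsupp ℝ x).2 ∈ cone L ∧
    total V (Finsupp.sumFinsuppLEquivProdFinsupp ℝ x).1 +
      total W (Finsupp.sumFinsuppLEquivProdFinsupp ℝ x).2 = 1 := by
  have h1 : (Finsupp.sumFinsuppLEquivProdFinsupp ℝ x).1.support = x.support.toLeft := by
    ext; simp
  have h2 : (Finsupp.sumFinsuppLEquivProdFinsupp ℝ x).2.support = x.support.toRight := by
    ext; simp
  have h3 : total V (Finsupp.sumFinsuppLEquivProdFinsupp ℝ x).1 +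
      total W (Finsupp.sumFinsuppLEquivProdFinsupp ℝ x).2 = total (V ⊕ W) x := by
    rw [total_eq_sum h1.subset, total_eq_sum h2.subset, total_eq_sum (subset_rfl),
      ← Finset.toLeft_disjSum_toRight (u := x.support), Finset.sum_disjSum]
    simp
  rw [mem_space_iff_cone, h3, cone, cone, cone]
  simp only [Set.mem_ofPred_eq, ← Finsupp.support_eq_empty, h1, h2, mem_join, Sum.forall,
    Finsupp.fst_sumFinsuppLEquivProdFinsupp, Finsupp.snd_sumFinsuppLEquivProdFinsupp,
    Finset.nonempty_iff_ne_empty]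
  have h4 : x.support = ∅ → x.support.toLeft = ∅ ∧ x.support.toRight = ∅ := by
    intro h; rw [h]; exact ⟨rfl, rfl⟩
  tauto

theorem PLHomeomorphic.join (h : PLHomeomorphic K K') (h' : PLHomeomorphic L L') :
    PLHomeomorphic (join K L) (join K' L') := by
  obtain ⟨f, g, hf, hg, hi, pf, pg⟩ := h
  obtain ⟨f', g', hf', hg', hi', pf', pg'⟩ := h'
  let e := Finsupp.sumFinsuppLEquivProdFinsupp ℝ (M := ℝ) (α := V) (β := W)
  let e' := Finsupp.sumFinsuppLEquivProdFinsupp ℝ (M := ℝ) (α := V') (β := W')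
  refine ⟨fun x => e'.symm (coneMap f (e x).1, coneMap f' (e x).2),
    fun x => e.symm (coneMap g (e' x).1, coneMap g' (e' x).2), fun x hx => ?_, fun x hx => ?_,
    ⟨fun x hx => ?_, fun x hx => ?_⟩, ?_, ?_⟩
  · obtain ⟨h1, h2, h3⟩ := mem_space_join.1 hx
    rw [mem_space_join, LinearEquiv.apply_symm_apply]
    refine ⟨coneMap_mem hf h1, coneMap_mem hf' h2, ?_⟩
    rw [total_coneMap hf h1, total_coneMap hf' h2, h3]
  · obtain ⟨h1, h2, h3⟩ := mem_space_join.1 hx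
    rw [mem_space_join, LinearEquiv.apply_symm_apply]
    refine ⟨coneMap_mem hg h1, coneMap_mem hg' h2, ?_⟩
    rw [total_coneMap hg h1, total_coneMap hg' h2, h3]
  · obtain ⟨h1, h2, h3⟩ := mem_space_join.1 hx
    simp only [LinearEquiv.apply_symm_apply]
    rw [coneMap_leftInv hf hi.1 h1, coneMap_leftInv hf' hi'.1 h2]
    exact e.symm_apply_apply x
  · obtain ⟨h1, h2, h3⟩ := mem_space_join.1 hx
    simp only [LinearEquiv.apply_symm_apply]
    rw [coneMap_leftInv hg hi.2 h1, coneMap_leftInv hg' hi'.2 h2]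
    exact e'.symm_apply_apply x
  · refine (isPLOn_linear e'.symm.toLinearMap Set.univ).comp (IsPLOn.prodMk
      ((isPLOn_coneMap pf).comp (isPLOn_linear (LinearMap.fst ℝ _ _ ∘ₗ e.toLinearMap) _) ?_)
      ((isPLOn_coneMap pf').comp (isPLOn_linear (LinearMap.snd ℝ _ _ ∘ₗ e.toLinearMap) _) ?_))
      (Set.mapsTo_univ _ _)
    · exact fun x hx => (mem_space_join.1 hx).1
    · exact fun x hx => (mem_space_join.1 hx).2.1
  · refine (isPLOn_linear e.symm.toLinearMap Set.univ).comp (IsPLOn.prodMk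
      ((isPLOn_coneMap pg).comp (isPLOn_linear (LinearMap.fst ℝ _ _ ∘ₗ e'.toLinearMap) _) ?_)
      ((isPLOn_coneMap pg').comp (isPLOn_linear (LinearMap.snd ℝ _ _ ∘ₗ e'.toLinearMap) _) ?_))
      (Set.mapsTo_univ _ _)
    · exact fun x hx => (mem_space_join.1 hx).1
    · exact fun x hx => (mem_space_join.1 hx).2.1

theorem space_eq_empty (h : K.faces = ∅) : space K.faces = ∅ := by
  simp [space, h]

theorem faces_join_eq_empty (hK : K.faces = ∅) (hL : L.faces = ∅) : (join K L).faces = ∅ := by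
  ext s
  simp only [mem_join, hK, hL, Set.mem_empty_iff_false, or_false, iff_false]
  rintro ⟨hs, h1, h2⟩
  rw [← Finset.toLeft_disjSum_toRight (u := s), h1, h2] at hs
  simp at hs

theorem plHomeomorphic_join_empty (h : L.faces = ∅) : PLHomeomorphic (join K L) K := by
  classical
  rcases isEmpty_or_nonempty V with hV | ⟨⟨v₀⟩⟩
  · have hK : K.faces = ∅ := by
      ext s
      simp only [Set.mem_empty_iff_false, iff_false]
      intro hs
      obtain ⟨v, -⟩ := face_nonempty K hs
      exact hV.elim v
    refine ⟨0, 0, ?_, ?_, ?_, ?_, ?_⟩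
    · rw [space_eq_empty (faces_join_eq_empty hK h)]; exact Set.mapsTo_empty _ _
    · rw [space_eq_empty hK]; exact Set.mapsTo_empty _ _
    · rw [space_eq_empty (faces_join_eq_empty hK h), space_eq_empty hK]
      exact ⟨fun _ h => h.elim, fun _ h => h.elim⟩
    · exact isPLOn_linear 0 _
    · exact isPLOn_linear 0 _
  · refine (iso_iff.2 ⟨Sum.elim id fun _ => v₀, Sum.inl, fun s hs => ?_, fun s hs => ?_, ?_,
      by simp⟩ : Iso _ _).plHomeomorphic
    · obtain ⟨h0, h1, h2⟩ := mem_join.1 hs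
      simp only [h, Set.mem_empty_iff_false, or_false] at h2
      have hsl : s = s.toLeft.disjSum ∅ := by rw [← h2, Finset.toLeft_disjSum_toRight]
      have hne : s.toLeft ≠ ∅ := by
        intro hc
        rw [hsl, hc] at h0
        simp at h0
      convert h1.resolve_left hne using 1
      conv_lhs => rw [hsl]
      ext v
      simp
    · have hl : (s.image (Sum.inl : V → V ⊕ W)).toLeft = s := by ext; simp
      have hr : (s.image (Sum.inl : V → V ⊕ W)).toRight = ∅ := by ext; simp
      rw [mem_join, hl, hr]
      exact ⟨(face_nonempty K hs).image _, Or.inr hs, Or.inl rfl⟩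
    · rintro (v | w) hv
      · simp
      · simp [h] at hv

end Complexes

/-! ### Simplices and their boundaries -/

section Simplices

variable {V W : Type*}

/-- The simplex on the vertex set `A`, with all its faces. -/
def fullSimplex (A : Finset V) : PreAbstractSimplicialComplex V where
  faces := {s | s.Nonempty ∧ s ⊆ A}
  isRelLowerSet_faces := fun _ hs => ⟨hs.1, fun _ hts ht => ⟨ht, hts.trans hs.2⟩⟩

/-- The boundary of the simplex on the vertex set `A`. -/
def boundarySimplex (A : Finset V) : PreAbstractSimplicialComplex V where
  faces := {s | s.Nonempty ∧ s ⊂ A}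
  isRelLowerSet_faces := fun _ hs => ⟨hs.1, fun _ hts ht => ⟨ht, hts.trans_ssubset hs.2⟩⟩

theorem mem_fullSimplex {A s : Finset V} : s ∈ (fullSimplex A).faces ↔ s.Nonempty ∧ s ⊆ A := Iff.rfl

theorem mem_boundarySimplex {A s : Finset V} :
    s ∈ (boundarySimplex A).faces ↔ s.Nonempty ∧ s ⊂ A := Iff.rfl

theorem iso_of_card_eq {A : Finset V} {B : Finset W} (hA : A.Nonempty) (h : A.card = B.card) :
    Iso (fullSimplex A) (fullSimplex B) ∧ Iso (boundarySimplex A) (boundarySimplex B) := by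
  classical
  have hB : B.Nonempty := by rwa [← Finset.card_pos, ← h, Finset.card_pos]
  obtain ⟨a₀, -⟩ := id hA
  obtain ⟨b₀, -⟩ := id hB
  let e : A ≃ B := Finset.equivOfCardEq h
  let φ : V → W := fun v => if hv : v ∈ A then (e ⟨v, hv⟩).1 else b₀
  let ψ : W → V := fun w => if hw : w ∈ B then (e.symm ⟨w, hw⟩).1 else a₀
  have hφ : ∀ v ∈ A, φ v ∈ B ∧ ψ (φ v) = v := by
    intro v hv
    have : φ v = (e ⟨v, hv⟩).1 := dif_pos hv
    have h2 : φ v ∈ B := this ▸ (e ⟨v, hv⟩).2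
    refine ⟨h2, ?_⟩
    have h3 : ψ (φ v) = (e.symm ⟨φ v, h2⟩).1 := dif_pos h2
    rw [h3]
    simp [this]
  have hψ : ∀ w ∈ B, ψ w ∈ A ∧ φ (ψ w) = w := by
    intro v hv
    have : ψ v = (e.symm ⟨v, hv⟩).1 := dif_pos hv
    have h2 : ψ v ∈ A := this ▸ (e.symm ⟨v, hv⟩).2
    refine ⟨h2, ?_⟩
    have h3 : φ (ψ v) = (e ⟨ψ v, h2⟩).1 := dif_pos h2
    rw [h3]
    simp [this]
  have hsub : ∀ s ⊆ A, s.image φ ⊆ B := fun s hs => Finset.image_subset_iff.2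
    fun v hv => (hφ v (hs hv)).1
  have hsub' : ∀ s ⊆ B, s.image ψ ⊆ A := fun s hs => Finset.image_subset_iff.2
    fun v hv => (hψ v (hs hv)).1
  have hc : ∀ s ⊆ A, (s.image φ).card = s.card := fun s hs => Finset.card_image_of_injOn
    fun v hv w hw hvw => by rw [← (hφ v (hs hv)).2, ← (hφ w (hs hw)).2, hvw]
  have hc' : ∀ s ⊆ B, (s.image ψ).card = s.card := fun s hs => Finset.card_image_of_injOn
    fun v hv w hw hvw => by rw [← (hψ v (hs hv)).2, ← (hψ w (hs hw)).2, hvw]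
  constructor
  · refine iso_iff.2 ⟨φ, ψ, fun s hs => ⟨hs.1.image _, hsub s hs.2⟩,
      fun s hs => ⟨hs.1.image _, hsub' s hs.2⟩, fun v hv => ?_, fun v hv => ?_⟩
    · exact (hφ v (by simpa using hv.2)).2
    · exact (hψ v (by simpa using hv.2)).2
  · refine iso_iff.2 ⟨φ, ψ, fun s hs => ⟨hs.1.image _, ?_⟩,
      fun s hs => ⟨hs.1.image _, ?_⟩, fun v hv => ?_, fun v hv => ?_⟩
    · refine (hsub s hs.2.subset).ssubset_of_ne fun h' => ?_
      have h1 := hc s hs.2.subset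
      have h2 := Finset.card_lt_card hs.2
      rw [h'] at h1
      omega
    · refine (hsub' s hs.2.subset).ssubset_of_ne fun h' => ?_
      have h1 := hc' s hs.2.subset
      have h2 := Finset.card_lt_card hs.2
      rw [h'] at h1
      omega
    · exact (hφ v (by simpa using hv.2.subset)).2
    · exact (hψ v (by simpa using hv.2.subset)).2

theorem simplex_eq (n : ℕ) : simplex n = fullSimplex Finset.univ := by
  ext s
  simp [simplex, mem_fullSimplex]

theorem simplexBoundary_eq (n : ℕ) : simplexBoundary n = boundarySimplex Finset.univ := by
  ext s
  simp [simplexBoundary, mem_boundarySimplex, Finset.ssubset_univ_iff]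

theorem fullSimplex_plHomeomorphic {A : Finset V} {n : ℕ} (h : A.card = n + 1) :
    PLHomeomorphic (fullSimplex A) (simplex n) := by
  rw [simplex_eq]
  exact (iso_of_card_eq (Finset.card_pos.1 (by omega)) (by simpa using h)).1.plHomeomorphic

theorem boundarySimplex_plHomeomorphic {A : Finset V} {n : ℕ} (h : A.card = n + 1) :
    PLHomeomorphic (boundarySimplex A) (simplexBoundary n) := by
  rw [simplexBoundary_eq]
  exact (iso_of_card_eq (Finset.card_pos.1 (by omega)) (by simpa using h)).2.plHomeomorphic

theorem join_fullSimplex (A : Finset V) (B : Finset W) :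
    join (fullSimplex A) (fullSimplex B) = fullSimplex (A.disjSum B) := by
  ext s
  rw [mem_join, mem_fullSimplex, mem_fullSimplex, mem_fullSimplex, Finset.subset_disjSum]
  simp only [Finset.nonempty_iff_ne_empty]
  refine and_congr_right fun _ => and_congr ?_ ?_
  · by_cases h : s.toLeft = ∅ <;> simp [h]
  · by_cases h : s.toRight = ∅ <;> simp [h]

end Simplices

/-! ### Joins of simplices and boundaries of simplices -/

section Stellar

variable {α β : Type*} [Fintype α] [Fintype β]

/-- The linear map that realizes the stellar subdivision of a simplex on `α ⊕ β` at its face `α`: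
the additional vertex goes to the barycenter of this face. -/
noncomputable def stellarMap (α β : Type*) [Fintype α] [Fintype β] :
    (α ⊕ Option β →₀ ℝ) →ₗ[ℝ] (α ⊕ β →₀ ℝ) where
  toFun x := Finsupp.equivFunOnFinite.symm (Sum.elim
    (fun a => x (Sum.inl a) + (Fintype.card α : ℝ)⁻¹ * x (Sum.inr none))
    (fun b => x (Sum.inr (some b))))
  map_add' x y := by
    ext (a | b)
    · simp
      ring
    · simp
  map_smul' r x := by
    ext (a | b)
    · simp
      ring
    · simp

@[simp] theorem stellarMap_inl (x : α ⊕ Option β →₀ ℝ) (a : α) :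
    stellarMap α β x (Sum.inl a) = x (Sum.inl a) + (Fintype.card α : ℝ)⁻¹ * x (Sum.inr none) := rfl

@[simp] theorem stellarMap_inr (x : α ⊕ Option β →₀ ℝ) (b : β) :
    stellarMap α β x (Sum.inr b) = x (Sum.inr (some b)) := rfl

theorem total_stellarMap [Nonempty α] (x : α ⊕ Option β →₀ ℝ) :
    total _ (stellarMap α β x) = total _ x := by
  rw [total_eq_sum (Finset.subset_univ _), total_eq_sum (Finset.subset_univ _), Fintype.sum_sum_type,
    Fintype.sum_sum_type, Fintype.sum_option]
  simp only [stellarMap_inl, stellarMap_inr, Finset.sum_add_distrib, Finset.sum_const,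
    Finset.card_univ, nsmul_eq_mul]
  rw [mul_inv_cancel_left₀ (by positivity)]
  ring

theorem stellarMap_injOn [Nonempty α] : Set.InjOn (stellarMap α β)
    {x | (∀ v, 0 ≤ x v) ∧ ∃ a, x (Sum.inl a) = 0} := by
  have hα : (0 : ℝ) < (Fintype.card α : ℝ)⁻¹ := by positivity
  have key : ∀ x y : α ⊕ Option β →₀ ℝ, (∀ v, 0 ≤ x v) → (∃ a, y (Sum.inl a) = 0) →
      stellarMap α β x = stellarMap α β y → x (Sum.inr none) ≤ y (Sum.inr none) := by
    rintro x y hx ⟨a, ha⟩ h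
    have h1 := DFunLike.congr_fun h (Sum.inl a)
    rw [stellarMap_inl, stellarMap_inl, ha] at h1
    have h2 := hx (Sum.inl a)
    exact le_of_mul_le_mul_left (by linarith) hα
  rintro x ⟨hx, hxa⟩ y ⟨hy, hya⟩ h
  have h0 := (key x y hx hya h).antisymm (key y x hy hxa h.symm)
  ext (a | _ | b)
  · have h1 := DFunLike.congr_fun h (Sum.inl a)
    rw [stellarMap_inl, stellarMap_inl, h0] at h1
    linarith
  · exact h0
  · exact DFunLike.congr_fun h (Sum.inr b)

theorem exists_stellarMap_eq [Nonempty α] {y : α ⊕ β →₀ ℝ} (hy : ∀ v, 0 ≤ y v) :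
    ∃ x, stellarMap α β x = y ∧ (∀ v, 0 ≤ x v) ∧ ∃ a₀, x (Sum.inl a₀) = 0 ∧
      (∀ a, y (Sum.inl a₀) ≤ y (Sum.inl a)) ∧
      x (Sum.inr none) = (Fintype.card α : ℝ) * y (Sum.inl a₀) := by
  obtain ⟨a₀, h0⟩ := Finite.exists_min fun a => y (Sum.inl a)
  refine ⟨Finsupp.equivFunOnFinite.symm (Sum.elim (fun a => y (Sum.inl a) - y (Sum.inl a₀))
    (fun o => o.elim (Fintype.card α * y (Sum.inl a₀)) fun b => y (Sum.inr b))), ?_, ?_, a₀, ?_, h0, ?_⟩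
  · ext (a | b)
    · simp
    · simp
  · rintro (a | _ | b)
    · simpa using h0 a
    · simpa using mul_nonneg (Nat.cast_nonneg _) (hy (Sum.inl a₀))
    · simpa using hy (Sum.inr b)
  · simp
  · simp

theorem support_nonempty_of_total {γ : Type*} {x : γ →₀ ℝ} (h : total γ x = 1) :
    x.support.Nonempty := by
  rw [Finsupp.support_nonempty_iff]
  rintro rfl
  simp at h

theorem mem_space_full {γ : Type*} [Fintype γ] {x : γ →₀ ℝ} :
    x ∈ space (fullSimplex (Finset.univ : Finset γ)).faces ↔ (∀ v, 0 ≤ x v) ∧ total γ x = 1 := by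
  rw [mem_space]
  exact and_congr_right fun _ => ⟨fun h => h.2,
    fun h => ⟨⟨support_nonempty_of_total h, Finset.subset_univ _⟩, h⟩⟩

theorem ssubset_univ_iff_exists {γ : Type*} [Fintype γ] {s : Finset γ} :
    s ⊂ Finset.univ ↔ ∃ v, v ∉ s := by
  rw [Finset.ssubset_univ_iff, ne_eq, Finset.eq_univ_iff_forall, not_forall]

theorem mem_space_boundary {γ : Type*} [Fintype γ] {x : γ →₀ ℝ} :
    x ∈ space (boundarySimplex (Finset.univ : Finset γ)).faces ↔
      (∀ v, 0 ≤ x v) ∧ total γ x = 1 ∧ ∃ v, x v = 0 := by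
  rw [mem_space]
  refine and_congr_right fun _ => ?_
  rw [mem_boundarySimplex, ssubset_univ_iff_exists]
  simp only [Finsupp.notMem_support_iff]
  exact ⟨fun h => ⟨h.2, h.1.2⟩, fun h => ⟨⟨support_nonempty_of_total h.1, h.2⟩, h.1⟩⟩

theorem eq_empty_or_mem_boundary {γ : Type*} [Fintype γ] [Nonempty γ] {s : Finset γ} :
    s = ∅ ∨ s ∈ (boundarySimplex (Finset.univ : Finset γ)).faces ↔ ∃ v, v ∉ s := by
  rw [mem_boundarySimplex, ssubset_univ_iff_exists]
  rcases s.eq_empty_or_nonempty with rfl | h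
  · simp
  · simp [h, h.ne_empty]

theorem eq_empty_or_mem_full {γ : Type*} [Fintype γ] {s : Finset γ} :
    s = ∅ ∨ s ∈ (fullSimplex (Finset.univ : Finset γ)).faces := by
  rcases s.eq_empty_or_nonempty with rfl | h
  · simp
  · exact Or.inr ⟨h, Finset.subset_univ _⟩

theorem finite_faces {γ : Type*} [Finite γ] (K : PreAbstractSimplicialComplex γ) :
    K.faces.Finite := Set.toFinite _

/-- A stellar subdivision of a simplex. -/
theorem join_boundary_full_plHomeomorphic [Nonempty α] :
    PLHomeomorphic (join (boundarySimplex (Finset.univ : Finset α))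
      (fullSimplex (Finset.univ : Finset (Option β))))
      (fullSimplex (Finset.univ : Finset (α ⊕ β))) := by
  have hmem : ∀ x, x ∈ space (join (boundarySimplex (Finset.univ : Finset α))
      (fullSimplex (Finset.univ : Finset (Option β)))).faces ↔
      (∀ v, 0 ≤ x v) ∧ total _ x = 1 ∧ ∃ a, x (Sum.inl a) = 0 := by
    intro x
    rw [mem_space, mem_join, eq_empty_or_mem_boundary]
    simp only [eq_empty_or_mem_full, and_true, Finset.mem_toLeft, Finsupp.notMem_support_iff]
    exact ⟨fun h => ⟨h.1, h.2.2, h.2.1.2⟩,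
      fun h => ⟨h.1, ⟨support_nonempty_of_total h.2.1, h.2.2⟩, h.2.1⟩⟩
  refine plHomeomorphic_of_linear (finite_faces _) (stellarMap α β) (fun x hx => ?_)
    (stellarMap_injOn.mono fun x hx => ?_) fun y hy => ?_
  · rw [hmem] at hx
    rw [mem_space_full, total_stellarMap]
    refine ⟨?_, hx.2.1⟩
    rintro (a | b)
    · have := hx.1 (Sum.inl a)
      have := hx.1 (Sum.inr none)
      rw [stellarMap_inl]
      positivity
    · exact hx.1 _
  · rw [hmem] at hx
    exact ⟨hx.1, hx.2.2⟩
  · rw [mem_space_full] at hy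
    obtain ⟨x, rfl, h1, a, ha, -⟩ := exists_stellarMap_eq hy.1
    refine ⟨x, (hmem x).2 ⟨h1, ?_, a, ha⟩, rfl⟩
    rw [← total_stellarMap, hy.2]

/-- A stellar subdivision of the boundary of a simplex. -/
theorem join_boundary_boundary_plHomeomorphic [Nonempty α] :
    PLHomeomorphic (join (boundarySimplex (Finset.univ : Finset α))
      (boundarySimplex (Finset.univ : Finset (Option β))))
      (boundarySimplex (Finset.univ : Finset (α ⊕ β))) := by
  have hmem : ∀ x, x ∈ space (join (boundarySimplex (Finset.univ : Finset α))
      (boundarySimplex (Finset.univ : Finset (Option β)))).faces ↔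
      (∀ v, 0 ≤ x v) ∧ total _ x = 1 ∧ (∃ a, x (Sum.inl a) = 0) ∧ ∃ o, x (Sum.inr o) = 0 := by
    intro x
    rw [mem_space, mem_join, eq_empty_or_mem_boundary, eq_empty_or_mem_boundary]
    simp only [Finset.mem_toLeft, Finset.mem_toRight, Finsupp.notMem_support_iff]
    exact ⟨fun h => ⟨h.1, h.2.2, h.2.1.2⟩,
      fun h => ⟨h.1, ⟨support_nonempty_of_total h.2.1, h.2.2⟩, h.2.1⟩⟩
  refine plHomeomorphic_of_linear (finite_faces _) (stellarMap α β) (fun x hx => ?_)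
    (stellarMap_injOn.mono fun x hx => ?_) fun y hy => ?_
  · rw [hmem] at hx
    rw [mem_space_boundary, total_stellarMap]
    refine ⟨?_, hx.2.1, ?_⟩
    · rintro (a | b)
      · have := hx.1 (Sum.inl a)
        have := hx.1 (Sum.inr none)
        rw [stellarMap_inl]
        positivity
      · exact hx.1 _
    · obtain ⟨-, -, ⟨a, ha⟩, o, ho⟩ := hx
      rcases o with _ | b
      · exact ⟨Sum.inl a, by simp [ha, ho]⟩
      · exact ⟨Sum.inr b, ho⟩
  · rw [hmem] at hx
    exact ⟨hx.1, hx.2.2.1⟩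
  · rw [mem_space_boundary] at hy
    obtain ⟨x, rfl, h1, a, ha, hmin, hnone⟩ := exists_stellarMap_eq hy.1
    refine ⟨x, (hmem x).2 ⟨h1, ?_, ⟨a, ha⟩, ?_⟩, rfl⟩
    · rw [← total_stellarMap, hy.2.1]
    · obtain ⟨v | b, hv⟩ := hy.2.2
      · refine ⟨none, ?_⟩
        have := (hv ▸ hmin v).antisymm (hy.1 _)
        rw [hnone, this, mul_zero]
      · exact ⟨some b, hv⟩

theorem join_simplex_simplex (a b : ℕ) :
    PLHomeomorphic (join (simplex a) (simplex b)) (simplex (a + b + 1)) := by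
  rw [simplex_eq a, simplex_eq b, join_fullSimplex]
  exact fullSimplex_plHomeomorphic (by simp; ring)

theorem join_boundary_simplex (a b : ℕ) :
    PLHomeomorphic (join (simplexBoundary (a + 1)) (simplex b)) (simplex (a + b + 1)) := by
  have h1 : PLHomeomorphic (simplexBoundary (a + 1))
      (boundarySimplex (Finset.univ : Finset (Fin (a + 2)))) :=
    (boundarySimplex_plHomeomorphic (by simp)).symm
  have h2 : PLHomeomorphic (simplex b) (fullSimplex (Finset.univ : Finset (Option (Fin b)))) :=
    (fullSimplex_plHomeomorphic (by simp)).symm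
  exact ((h1.join h2).trans join_boundary_full_plHomeomorphic).trans
    (fullSimplex_plHomeomorphic (by simp; ring))

theorem join_boundary_boundary (a b : ℕ) :
    PLHomeomorphic (join (simplexBoundary (a + 1)) (simplexBoundary (b + 1)))
      (simplexBoundary (a + b + 1 + 1)) := by
  have h1 : PLHomeomorphic (simplexBoundary (a + 1))
      (boundarySimplex (Finset.univ : Finset (Fin (a + 2)))) :=
    (boundarySimplex_plHomeomorphic (by simp)).symm
  have h2 : PLHomeomorphic (simplexBoundary (b + 1))
      (boundarySimplex (Finset.univ : Finset (Option (Fin (b + 1))))) :=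
    (boundarySimplex_plHomeomorphic (by simp)).symm
  exact ((h1.join h2).trans join_boundary_boundary_plHomeomorphic).trans
    (boundarySimplex_plHomeomorphic (by simp; ring))

end Stellar

/-! ### Combinatorial spheres and disks -/

section SphereOrDisk

variable {V W : Type*} {K : PreAbstractSimplicialComplex V} {L : PreAbstractSimplicialComplex W}

/-- `K` is a combinatorial disk of dimension `r - 1` if `p` holds, and a combinatorial sphere of this
dimension if `p` fails. Under joins, `r` is additive and `p` behaves like a disjunction. -/
def IsCombSphereOrDisk (p : Prop) (r : ℕ) (K : PreAbstractSimplicialComplex V) : Prop :=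
  (p ∧ IsCombDisk r K) ∨ (¬ p ∧ IsCombSphere r K)

/-- `|K|` is PL-homeomorphic to an `r`-simplex if `p` holds, and to the boundary of an
`(r + 1)`-simplex if `p` fails. -/
def IsPLSphereOrDisk (p : Prop) (r : ℕ) (K : PreAbstractSimplicialComplex V) : Prop :=
  (p ∧ PLHomeomorphic K (simplex r)) ∨ (¬ p ∧ PLHomeomorphic K (simplexBoundary (r + 1)))

theorem IsCombSphereOrDisk.congr {p q : Prop} {r : ℕ} (h : IsCombSphereOrDisk p r K) (hpq : p ↔ q) :
    IsCombSphereOrDisk q r K := by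
  rwa [← propext hpq]

theorem isCombSphereOrDisk_zero {p : Prop} :
    IsCombSphereOrDisk p 0 K ↔ ¬ p ∧ K.faces = ∅ := by
  simp [IsCombSphereOrDisk, IsCombDisk, IsCombSphere]

theorem exists_isCombSphereOrDisk {r : ℕ} :
    (IsCombSphere r K ∨ IsCombDisk r K) ↔ ∃ q, IsCombSphereOrDisk q r K := by
  constructor
  · rintro (h | h)
    · exact ⟨False, Or.inr ⟨not_false, h⟩⟩
    · exact ⟨True, Or.inl ⟨trivial, h⟩⟩
  · rintro ⟨q, ⟨-, h⟩ | ⟨-, h⟩⟩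
    exacts [Or.inr h, Or.inl h]

theorem isCombSphereOrDisk_succ {p : Prop} {r : ℕ} : IsCombSphereOrDisk p (r + 1) K ↔
    (∀ v, {v} ∈ K.faces → ∃ q : Prop, (q → p) ∧ IsCombSphereOrDisk q r (link K {v})) ∧
      IsPLSphereOrDisk p r K := by
  by_cases hp : p
  · simp only [IsCombSphereOrDisk, IsPLSphereOrDisk, IsCombDisk, hp, true_and, not_true_eq_false,
      false_and, or_false, imp_true_iff]
    refine and_congr_left fun _ => forall₂_congr fun v _ => ?_
    exact exists_isCombSphereOrDisk
  · simp only [IsCombSphereOrDisk, IsPLSphereOrDisk, IsCombSphere, hp, not_false_eq_true, true_and,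
      false_and, false_or, imp_false]
    refine and_congr_left fun _ => forall₂_congr fun v _ => ?_
    constructor
    · exact fun h => ⟨False, not_false, Or.inr ⟨not_false, h⟩⟩
    · rintro ⟨q, hq, ⟨h, -⟩ | ⟨-, h⟩⟩
      exacts [absurd h hq, h]

theorem IsPLSphereOrDisk.of_plHomeomorphic {p : Prop} {r : ℕ} (h : IsPLSphereOrDisk p r L)
    (hKL : PLHomeomorphic K L) : IsPLSphereOrDisk p r K :=
  h.imp (fun h => ⟨h.1, hKL.trans h.2⟩) fun h => ⟨h.1, hKL.trans h.2⟩

theorem IsPLSphereOrDisk.join {p q : Prop} {a b : ℕ} (hK : IsPLSphereOrDisk p a K)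
    (hL : IsPLSphereOrDisk q b L) : IsPLSphereOrDisk (p ∨ q) (a + b + 1) (join K L) := by
  rcases hK with ⟨hp, hK⟩ | ⟨hp, hK⟩ <;> rcases hL with ⟨hq, hL⟩ | ⟨hq, hL⟩
  · exact Or.inl ⟨Or.inl hp, (hK.join hL).trans (join_simplex_simplex a b)⟩
  · refine Or.inl ⟨Or.inl hp, (hK.join hL).trans ((join_comm_iso _ _).plHomeomorphic.trans ?_)⟩
    rw [add_comm a b]
    exact join_boundary_simplex b a
  · exact Or.inl ⟨Or.inr hq, (hK.join hL).trans (join_boundary_simplex a b)⟩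
  · exact Or.inr ⟨by tauto, (hK.join hL).trans (join_boundary_boundary a b)⟩

theorem IsCombSphereOrDisk.of_iso {p : Prop} {r : ℕ} (h : IsCombSphereOrDisk p r K)
    (hKL : Iso K L) : IsCombSphereOrDisk p r L := by
  induction r generalizing V W p with
  | zero =>
    classical
    rw [isCombSphereOrDisk_zero] at h ⊢
    refine ⟨h.1, ?_⟩
    obtain ⟨φ, ψ, -, h2, -⟩ := iso_iff.1 hKL
    ext t
    simp only [Set.mem_empty_iff_false, iff_false]
    intro ht
    have := h2 t ht
    rw [h.2] at this
    exact this
  | succ r ih =>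
    rw [isCombSphereOrDisk_succ] at h ⊢
    refine ⟨fun w hw => ?_, h.2.of_plHomeomorphic hKL.symm.plHomeomorphic⟩
    obtain ⟨v, hv, hvw⟩ := hKL.exists_link hw
    obtain ⟨q, hq, h'⟩ := h.1 v hv
    exact ⟨q, hq, ih h' hvw⟩

theorem IsCombSphereOrDisk.join {p q : Prop} {a b : ℕ} (hK : IsCombSphereOrDisk p a K)
    (hL : IsCombSphereOrDisk q b L) : IsCombSphereOrDisk (p ∨ q) (a + b) (join K L) := by
  obtain ⟨n, hn⟩ : ∃ n, n = a + b := ⟨_, rfl⟩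
  rw [← hn]
  induction n generalizing V W p q a b with
  | zero =>
    obtain ⟨rfl, rfl⟩ : a = 0 ∧ b = 0 := by omega
    rw [isCombSphereOrDisk_zero] at hK hL ⊢
    exact ⟨by tauto, faces_join_eq_empty hK.2 hL.2⟩
  | succ n ih =>
    rw [isCombSphereOrDisk_succ]
    constructor
    · rintro (v | w) hv
      · rw [singleton_inl_mem_join] at hv
        rw [link_join_inl hv]
        rcases a with _ | a
        · rw [isCombSphereOrDisk_zero] at hK
          rw [hK.2] at hv
          exact hv.elim
        · obtain ⟨p', hp', h⟩ := (isCombSphereOrDisk_succ.1 hK).1 v hv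
          exact ⟨p' ∨ q, Or.imp_left hp', ih h hL (by omega)⟩
      · rw [singleton_inr_mem_join] at hv
        rw [link_join_inr hv]
        rcases b with _ | b
        · rw [isCombSphereOrDisk_zero] at hL
          rw [hL.2] at hv
          exact hv.elim
        · obtain ⟨q', hq', h⟩ := (isCombSphereOrDisk_succ.1 hL).1 w hv
          exact ⟨p ∨ q', Or.imp_right hq', ih hK h (by omega)⟩
    · rcases a with _ | a
      · obtain rfl : b = n + 1 := by omega
        rw [isCombSphereOrDisk_zero] at hK
        have := (isCombSphereOrDisk_succ.1 hL).2
        rw [show (p ∨ q) = q by simp [hK.1]]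
        exact this.of_plHomeomorphic ((join_comm_iso _ _).plHomeomorphic.trans
          (plHomeomorphic_join_empty hK.2))
      · rcases b with _ | b
        · obtain rfl : a = n := by omega
          rw [isCombSphereOrDisk_zero] at hL
          have := (isCombSphereOrDisk_succ.1 hK).2
          rw [show (p ∨ q) = p by simp [hL.1]]
          exact this.of_plHomeomorphic (plHomeomorphic_join_empty hL.2)
        · obtain rfl : n = a + b + 1 := by omega
          exact (isCombSphereOrDisk_succ.1 hK).2.join (isCombSphereOrDisk_succ.1 hL).2

theorem link_link [DecidableEq V] {s t : Finset V} (hts : t ⊂ s) :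
    link (link K t) (s \ t) = link K s := by
  ext u
  rw [mem_link, mem_link, mem_link]
  have h1 : u ∪ s \ t ∪ t = u ∪ s := by
    rw [Finset.union_assoc, Finset.sdiff_union_of_subset hts.subset]
  rw [h1]
  refine and_congr_right fun hu => ?_
  constructor
  · rintro ⟨h2, -, h3, h4⟩
    refine ⟨?_, h4⟩
    rw [← Finset.sdiff_union_of_subset hts.subset, Finset.disjoint_union_right]
    exact ⟨h2, (Finset.disjoint_union_left.1 h3).1⟩
  · rintro ⟨h2, h3⟩
    refine ⟨h2.mono_right Finset.sdiff_subset, hu.mono Finset.subset_union_left, ?_, h3⟩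
    rw [Finset.disjoint_union_left]
    exact ⟨h2.mono_right hts.subset, Finset.sdiff_disjoint⟩

theorem sdiff_mem_link [DecidableEq V] {s t : Finset V} (hs : s ∈ K.faces) (hts : t ⊂ s) :
    s \ t ∈ (link K t).faces := by
  rw [mem_link, Finset.sdiff_union_of_subset hts.subset]
  exact ⟨Finset.sdiff_nonempty.2 hts.2, Finset.sdiff_disjoint, hs⟩

theorem IsCombSphereOrDisk.link {p : Prop} {r : ℕ} (h : IsCombSphereOrDisk p r K) {s : Finset V}
    (hs : s ∈ K.faces) : ∃ (q : Prop) (r' : ℕ), (q → p) ∧ r' + s.card = r ∧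
      IsCombSphereOrDisk q r' (link K s) := by
  classical
  induction r generalizing K p s with
  | zero =>
    rw [isCombSphereOrDisk_zero] at h
    rw [h.2] at hs
    exact hs.elim
  | succ r ih =>
    obtain ⟨v, hv⟩ := face_nonempty K hs
    obtain ⟨q, hq, h'⟩ := (isCombSphereOrDisk_succ.1 h).1 v (vertex_mem K hs hv)
    by_cases hsv : s = {v}
    · exact ⟨q, r, hq, by simp [hsv], hsv ▸ h'⟩
    · have hss : {v} ⊂ s := (Finset.singleton_subset_iff.2 hv).ssubset_of_ne (Ne.symm hsv)
      obtain ⟨q', r', hq', hr', h''⟩ := ih h' (sdiff_mem_link hs hss)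
      rw [link_link hss] at h''
      refine ⟨q', r', hq ∘ hq', ?_, h''⟩
      rw [Finset.card_sdiff_of_subset hss.subset, Finset.card_singleton] at hr'
      have := Finset.card_pos.2 ⟨v, hv⟩
      omega

theorem IsCombSphereOrDisk.finite {p : Prop} {r : ℕ} (h : IsCombSphereOrDisk p r K) :
    K.faces.Finite := by
  rcases r with _ | r
  · rw [(isCombSphereOrDisk_zero.1 h).2]
    exact Set.finite_empty
  · rcases (isCombSphereOrDisk_succ.1 h).2 with ⟨-, h⟩ | ⟨-, h⟩ <;> exact h.finite

/-- No complex is both a combinatorial sphere and a combinatorial disk. -/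
theorem IsCombSphere.not_isCombDisk {r r' : ℕ} (h : IsCombSphere r K) : ¬ IsCombDisk r' K := by
  intro h'
  rcases r' with _ | r'
  · exact h'
  rcases r with _ | r
  · obtain ⟨f, g, -, hg, -⟩ := h'.2
    have h1 : Finsupp.single 0 1 ∈ space (simplex r').faces := by
      rw [simplex_eq, mem_space_full]
      refine ⟨fun v => ?_, by simp⟩
      rw [Finsupp.single_apply]
      split_ifs <;> norm_num
    have := hg h1
    rw [space_eq_empty h] at this
    exact this
  · exact not_plHomeomorphic_simplexBoundary_simplex _ _ (h.2.symm.trans h'.2)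

theorem IsCombSphereOrDisk.iff_exists_isCombDisk {p : Prop} {r : ℕ}
    (h : IsCombSphereOrDisk p r K) : p ↔ ∃ r', IsCombDisk r' K := by
  rcases h with ⟨hp, h⟩ | ⟨hp, h⟩
  · exact ⟨fun _ => ⟨r, h⟩, fun _ => hp⟩
  · exact ⟨fun h => absurd h hp, fun ⟨r', h'⟩ => (h.not_isCombDisk h').elim⟩

theorem link_fullSimplex [DecidableEq V] {A : Finset V} {v : V} (hv : v ∈ A) :
    link (fullSimplex A) {v} = fullSimplex (A.erase v) := by
  ext s
  rw [mem_link_singleton, mem_fullSimplex, mem_fullSimplex, Finset.insert_subset_iff,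
    Finset.subset_erase]
  have := Finset.insert_nonempty v s
  tauto

theorem link_boundarySimplex [DecidableEq V] {A : Finset V} {v : V} (hv : v ∈ A) :
    link (boundarySimplex A) {v} = boundarySimplex (A.erase v) := by
  ext s
  rw [mem_link_singleton, mem_boundarySimplex, mem_boundarySimplex]
  refine and_congr_right fun _ => ?_
  constructor
  · rintro ⟨h1, -, h2⟩
    refine (Finset.subset_erase.2 ⟨(Finset.subset_insert v s).trans h2.subset, h1⟩).ssubset_of_ne ?_
    rintro rfl
    rw [Finset.insert_erase hv] at h2
    exact h2.ne rfl
  · intro h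
    have h1 : v ∉ s := fun hc => Finset.notMem_erase v A (h.subset hc)
    refine ⟨h1, Finset.insert_nonempty v s, ?_⟩
    refine (Finset.insert_subset hv (h.subset.trans (Finset.erase_subset _ _))).ssubset_of_ne ?_
    rintro rfl
    rw [Finset.erase_insert h1] at h
    exact h.ne rfl

theorem isCombSphereOrDisk_fullSimplex (A : Finset V) :
    IsCombSphereOrDisk A.Nonempty A.card (fullSimplex A) := by
  classical
  obtain ⟨n, hn⟩ : ∃ n, n = A.card := ⟨_, rfl⟩
  rw [← hn]
  induction n generalizing A with
  | zero =>
    rw [isCombSphereOrDisk_zero]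
    obtain rfl := Finset.card_eq_zero.1 hn.symm
    refine ⟨by simp, ?_⟩
    ext s
    simp only [mem_fullSimplex, Finset.subset_empty, Set.mem_empty_iff_false, iff_false]
    rintro ⟨h, rfl⟩
    simp at h
  | succ n ih =>
    have hA : A.Nonempty := Finset.card_pos.1 (by omega)
    rw [isCombSphereOrDisk_succ]
    refine ⟨fun v hv => ?_, Or.inl ⟨hA, fullSimplex_plHomeomorphic hn.symm⟩⟩
    have hv' : v ∈ A := by simpa using hv.2
    rw [link_fullSimplex hv']
    exact ⟨_, fun _ => hA, ih _ (by rw [Finset.card_erase_of_mem hv']; omega)⟩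

theorem isCombSphereOrDisk_boundarySimplex (A : Finset V) (hA : A.Nonempty) :
    IsCombSphereOrDisk False (A.card - 1) (boundarySimplex A) := by
  classical
  obtain ⟨n, hn⟩ : ∃ n, n + 1 = A.card := ⟨A.card - 1, Nat.succ_pred (Finset.card_pos.2 hA).ne'⟩
  rw [← hn, Nat.add_sub_cancel]
  induction n generalizing A with
  | zero =>
    rw [isCombSphereOrDisk_zero]
    refine ⟨not_false, ?_⟩
    ext s
    simp only [mem_boundarySimplex, Set.mem_empty_iff_false, iff_false]
    rintro ⟨h, h'⟩
    have := Finset.card_lt_card h'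
    have := Finset.card_pos.2 h
    omega
  | succ n ih =>
    rw [isCombSphereOrDisk_succ]
    refine ⟨fun v hv => ⟨False, id, ?_⟩, Or.inr ⟨not_false,
      boundarySimplex_plHomeomorphic hn.symm⟩⟩
    have hv' : v ∈ A := by simpa using hv.2.subset
    have hc : (A.erase v).card = n + 1 := by rw [Finset.card_erase_of_mem hv']; omega
    rw [link_boundarySimplex hv']
    exact ih _ (Finset.card_pos.1 (by omega)) hc.symm

end SphereOrDisk

/-! ### Order complexes and barycentric subdivisions -/

section Chains

variable {V W : Type*} {K : PreAbstractSimplicialComplex V}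

/-- The order complex of a set `P` of finite sets: its faces are the nonempty finite chains in `P`.
The barycentric subdivision of `K` is the case `P = K.faces`. -/
def chains (P : Set (Finset V)) : PreAbstractSimplicialComplex (Finset V) where
  faces := {S | S.Nonempty ∧ (∀ s ∈ S, s ∈ P) ∧ ∀ s ∈ S, ∀ t ∈ S, s ⊆ t ∨ t ⊆ s}
  isRelLowerSet_faces := fun _ h => ⟨h.1, fun _ hts ht =>
    ⟨ht, fun s hs => h.2.1 s (hts hs),
      fun s hs t ht => h.2.2 s (hts hs) t (hts ht)⟩⟩

theorem mem_chains {P : Set (Finset V)} {S : Finset (Finset V)} : S ∈ (chains P).faces ↔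
    S.Nonempty ∧ (∀ s ∈ S, s ∈ P) ∧ ∀ s ∈ S, ∀ t ∈ S, s ⊆ t ∨ t ⊆ s := Iff.rfl

theorem chains_faces : chains K.faces = barycentricSubdivision K := rfl

@[simp] theorem singleton_mem_chains {P : Set (Finset V)} {s : Finset V} :
    {s} ∈ (chains P).faces ↔ s ∈ P := by
  simp [mem_chains]

theorem exists_top {S : Finset (Finset V)} (hS : S.Nonempty)
    (h : ∀ s ∈ S, ∀ t ∈ S, s ⊆ t ∨ t ⊆ s) : ∃ u ∈ S, ∀ s ∈ S, s ⊆ u := by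
  obtain ⟨u, hu, hmax⟩ := Finset.exists_max_image S Finset.card hS
  refine ⟨u, hu, fun s hs => (h s hs u hu).elim id fun hus => ?_⟩
  rw [Finset.eq_of_subset_of_card_le hus (hmax s hs)]

theorem exists_bot {S : Finset (Finset V)} (hS : S.Nonempty)
    (h : ∀ s ∈ S, ∀ t ∈ S, s ⊆ t ∨ t ⊆ s) : ∃ l ∈ S, ∀ s ∈ S, l ⊆ s := by
  obtain ⟨l, hl, hmin⟩ := Finset.exists_min_image S Finset.card hS
  refine ⟨l, hl, fun s hs => (h l hl s hs).elim id fun hsl => ?_⟩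
  rw [Finset.eq_of_subset_of_card_le hsl (hmin s hs)]

theorem chains_iso {P : Set (Finset V)} {P' : Set (Finset W)} (φ : Finset V → Finset W)
    (ψ : Finset W → Finset V) (hφ : ∀ s ∈ P, φ s ∈ P' ∧ ψ (φ s) = s)
    (hψ : ∀ t ∈ P', ψ t ∈ P ∧ φ (ψ t) = t)
    (hφ' : ∀ s ∈ P, ∀ t ∈ P, s ⊆ t → φ s ⊆ φ t ∨ φ t ⊆ φ s)
    (hψ' : ∀ s ∈ P', ∀ t ∈ P', s ⊆ t → ψ s ⊆ ψ t ∨ ψ t ⊆ ψ s) :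
    Iso (chains P) (chains P') := by
  classical
  refine iso_iff.2 ⟨φ, ψ, fun S hS => ⟨hS.1.image _, ?_, ?_⟩, fun S hS => ⟨hS.1.image _, ?_, ?_⟩,
    fun s hs => (hφ s (singleton_mem_chains.1 hs)).2,
    fun s hs => (hψ s (singleton_mem_chains.1 hs)).2⟩
  · simp only [Finset.forall_mem_image]
    exact fun s hs => (hφ s (hS.2.1 s hs)).1
  · simp only [Finset.forall_mem_image]
    intro s hs t ht
    rcases hS.2.2 s hs t ht with h | h
    · exact hφ' s (hS.2.1 s hs) t (hS.2.1 t ht) h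
    · exact (hφ' t (hS.2.1 t ht) s (hS.2.1 s hs) h).symm
  · simp only [Finset.forall_mem_image]
    exact fun s hs => (hψ s (hS.2.1 s hs)).1
  · simp only [Finset.forall_mem_image]
    intro s hs t ht
    rcases hS.2.2 s hs t ht with h | h
    · exact hψ' s (hS.2.1 s hs) t (hS.2.1 t ht) h
    · exact (hψ' t (hS.2.1 t ht) s (hS.2.1 s hs) h).symm

theorem link_empty (K : PreAbstractSimplicialComplex V) : link K ∅ = K := by
  classical
  ext s
  rw [mem_link]
  simp only [Finset.disjoint_empty_right, true_and, Finset.union_empty, and_iff_right_iff_imp]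
  exact face_nonempty K

/-- The link of a chain with largest element `u` is the join of what lies below `u` and of what lies
above `u`. -/
theorem link_chains_iso [DecidableEq V] {P : Set (Finset V)} {S : Finset (Finset V)}
    (hS : S ∈ (chains P).faces) {u : Finset V} (hu : u ∈ S) (hmax : ∀ s ∈ S, s ⊆ u) :
    Iso (link (chains P) S) (join (link (chains {t | t ∈ P ∧ t ⊂ u}) (S.erase u))
      (chains {t | t ∈ P ∧ u ⊂ t})) := by
  classical
  have hcmp : ∀ T : Finset (Finset V), T ∈ (link (chains P) S).faces → ∀ t ∈ T, t ⊂ u ∨ u ⊂ t := by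
    intro T hT t ht
    obtain ⟨-, h1, h2⟩ := mem_link.1 hT
    have hne : t ≠ u := by
      rintro rfl
      exact Finset.disjoint_left.1 h1 ht hu
    rcases h2.2.2 t (Finset.mem_union_left _ ht) u (Finset.mem_union_right _ hu) with h | h
    · exact Or.inl (h.ssubset_of_ne hne)
    · exact Or.inr (h.ssubset_of_ne hne.symm)
  have hSu : ∀ s ∈ S.erase u, s ⊂ u := fun s hs =>
    (hmax s (Finset.mem_of_mem_erase hs)).ssubset_of_ne (Finset.ne_of_mem_erase hs)
  refine iso_iff.2 ⟨fun t => if t ⊂ u then Sum.inl t else Sum.inr t, Sum.elim id id,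
    fun T hT => ?_, fun T hT => ?_, fun t ht => ?_, ?_⟩
  · obtain ⟨h0, h1, h2⟩ := mem_link.1 hT
    have hl : (T.image fun t => if t ⊂ u then Sum.inl t else Sum.inr t : Finset (_ ⊕ _)).toLeft =
        T.filter (· ⊂ u) := by
      ext t
      simp only [Finset.mem_toLeft, Finset.mem_image, Finset.mem_filter]
      constructor
      · rintro ⟨t', ht', h⟩
        split_ifs at h with h3
        obtain rfl := Sum.inl_injective h
        exact ⟨ht', h3⟩
      · rintro ⟨ht, h⟩
        exact ⟨t, ht, if_pos h⟩
    have hr : (T.image fun t => if t ⊂ u then Sum.inl t else Sum.inr t : Finset (_ ⊕ _)).toRight =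
        T.filter (u ⊂ ·) := by
      ext t
      simp only [Finset.mem_toRight, Finset.mem_image, Finset.mem_filter]
      constructor
      · rintro ⟨t', ht', h⟩
        split_ifs at h with h3
        obtain rfl := Sum.inr_injective h
        exact ⟨ht', (hcmp T hT _ ht').resolve_left h3⟩
      · rintro ⟨ht, h⟩
        exact ⟨t, ht, if_neg fun h' => h'.not_subset h.subset⟩
    rw [mem_join, hl, hr]
    refine ⟨h0.image _, ?_, ?_⟩
    · rw [or_iff_not_imp_left, ← ne_eq, ← Finset.nonempty_iff_ne_empty, mem_link]
      intro hne
      have hsub : T.filter (· ⊂ u) ∪ S.erase u ⊆ T ∪ S :=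
        Finset.union_subset_union (Finset.filter_subset _ _) (Finset.erase_subset _ _)
      refine ⟨hne, h1.mono (Finset.filter_subset _ _) (Finset.erase_subset _ _),
        hne.mono Finset.subset_union_left, fun s hs => ⟨h2.2.1 s (hsub hs), ?_⟩,
        fun s hs t ht => h2.2.2 s (hsub hs) t (hsub ht)⟩
      rcases Finset.mem_union.1 hs with h | h
      · exact (Finset.mem_filter.1 h).2
      · exact hSu s h
    · rw [or_iff_not_imp_left, ← ne_eq, ← Finset.nonempty_iff_ne_empty, mem_chains]
      intro hne
      have hsub : T.filter (u ⊂ ·) ⊆ T ∪ S :=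
        (Finset.filter_subset _ _).trans Finset.subset_union_left
      exact ⟨hne, fun s hs => ⟨h2.2.1 s (hsub hs), (Finset.mem_filter.1 hs).2⟩,
        fun s hs t ht => h2.2.2 s (hsub hs) t (hsub ht)⟩
  · obtain ⟨h0, h1, h2⟩ := mem_join.1 hT
    rw [mem_link] at h1
    rw [mem_chains] at h2
    have h1' : ∀ t, Sum.inl t ∈ T → (t ∈ P ∧ t ⊂ u) ∧ t ∉ S ∧ (∀ s ∈ S, s ⊆ t ∨ t ⊆ s) ∧
        ∀ s, Sum.inl s ∈ T → s ⊆ t ∨ t ⊆ s := by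
      intro t ht
      have ht' := Finset.mem_toLeft.2 ht
      obtain ⟨-, h3, -, h4, h5⟩ := h1.resolve_left (Finset.ne_empty_of_mem ht')
      have h6 := h4 t (Finset.mem_union_left _ ht')
      have h7 := Finset.disjoint_left.1 h3 ht'
      refine ⟨h6, fun h => h7 (Finset.mem_erase.2 ⟨h6.2.ne, h⟩), fun s hs => ?_, fun s hs => ?_⟩
      · by_cases hsu : s = u
        · exact Or.inr (hsu ▸ h6.2.subset)
        · exact h5 s (Finset.mem_union_right _ (Finset.mem_erase.2 ⟨hsu, hs⟩)) t
            (Finset.mem_union_left _ ht')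
      · exact h5 s (Finset.mem_union_left _ (Finset.mem_toLeft.2 hs)) t
          (Finset.mem_union_left _ ht')
    have h2' : ∀ t, Sum.inr t ∈ T → (t ∈ P ∧ u ⊂ t) ∧ ∀ s, Sum.inr s ∈ T → s ⊆ t ∨ t ⊆ s := by
      intro t ht
      have ht' := Finset.mem_toRight.2 ht
      obtain ⟨-, h4, h5⟩ := h2.resolve_left (Finset.ne_empty_of_mem ht')
      exact ⟨h4 t ht', fun s hs => h5 s (Finset.mem_toRight.2 hs) t ht'⟩
    rw [mem_link]
    refine ⟨h0.image _, ?_, (h0.image _).mono Finset.subset_union_left, ?_, ?_⟩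
    · rw [Finset.disjoint_left]
      simp only [Finset.forall_mem_image]
      rintro (t | t) ht hc
      · exact (h1' t ht).2.1 hc
      · exact (h2' t ht).1.2.not_subset (hmax t hc)
    · intro s hs
      rcases Finset.mem_union.1 hs with h | h
      · obtain ⟨t | t, ht, rfl⟩ := Finset.mem_image.1 h
        · exact (h1' t ht).1.1
        · exact (h2' t ht).1.1
      · exact hS.2.1 s h
    · intro s hs t ht
      rcases Finset.mem_union.1 hs with h | h <;> rcases Finset.mem_union.1 ht with h' | h'
      · obtain ⟨s' | s', hs', rfl⟩ := Finset.mem_image.1 h <;>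
          obtain ⟨t' | t', ht', rfl⟩ := Finset.mem_image.1 h'
        · exact (h1' t' ht').2.2.2 _ hs'
        · exact Or.inl ((h1' s' hs').1.2.subset.trans (h2' t' ht').1.2.subset)
        · exact Or.inr ((h1' t' ht').1.2.subset.trans (h2' s' hs').1.2.subset)
        · exact (h2' t' ht').2 _ hs'
      · obtain ⟨s' | s', hs', rfl⟩ := Finset.mem_image.1 h
        · exact ((h1' s' hs').2.2.1 _ h').symm
        · exact Or.inr ((hmax t h').trans (h2' s' hs').1.2.subset)
      · obtain ⟨t' | t', ht', rfl⟩ := Finset.mem_image.1 h'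
        · exact (h1' t' ht').2.2.1 _ h
        · exact Or.inl ((hmax s h).trans (h2' t' ht').1.2.subset)
      · exact hS.2.2 s h t h'
  · beta_reduce
    split_ifs <;> rfl
  · rintro (t | t) ht
    · rw [singleton_inl_mem_join, mem_link] at ht
      exact if_pos (ht.2.2.2.1 t (by simp)).2
    · rw [singleton_inr_mem_join, singleton_mem_chains] at ht
      exact if_neg fun h => h.not_subset ht.2.subset

theorem chains_above_iso (s : Finset V) :
    Iso (barycentricSubdivision (link K s)) (chains {t | t ∈ K.faces ∧ s ⊂ t}) := by
  classical
  rw [← chains_faces]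
  refine chains_iso (fun t => t ∪ s) (fun t => t \ s) (fun t ht => ?_) (fun t ht => ?_)
    (fun t _ t' _ h => Or.inl (Finset.union_subset_union_left h))
    (fun t _ t' _ h => Or.inl (Finset.sdiff_subset_sdiff h subset_rfl))
  · obtain ⟨h0, h1, h2⟩ := mem_link.1 ht
    refine ⟨⟨h2, Finset.subset_union_right.ssubset_of_ne fun h => ?_⟩, ?_⟩
    · obtain ⟨v, hv⟩ := h0
      exact Finset.disjoint_left.1 h1 hv (h ▸ Finset.mem_union_left _ hv)
    · rw [Finset.union_sdiff_right, Finset.sdiff_eq_self_of_disjoint h1]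
  · exact ⟨sdiff_mem_link ht.1 ht.2, Finset.sdiff_union_of_subset ht.2.subset⟩

/-! ### The realization of the barycentric subdivision -/

/-- The linear map which sends each vertex of a barycentric subdivision to its barycenter. -/
noncomputable def baryMap (V : Type*) : (Finset V →₀ ℝ) →ₗ[ℝ] (V →₀ ℝ) :=
  Finsupp.linearCombination ℝ barycenter

theorem barycenter_apply [DecidableEq V] (s : Finset V) (v : V) :
    barycenter s v = if v ∈ s then (s.card : ℝ)⁻¹ else 0 := by
  simp [barycenter, Finsupp.single_apply, Finsupp.finsetSum_apply]

theorem total_barycenter {s : Finset V} (hs : s.Nonempty) : total V (barycenter s) = 1 := by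
  have : (s.card : ℝ) ≠ 0 := by exact_mod_cast (Finset.card_pos.2 hs).ne'
  simp [barycenter, this]

theorem baryMap_apply [DecidableEq V] (y : Finset V →₀ ℝ) (v : V) :
    baryMap V y v = ∑ s ∈ y.support with v ∈ s, y s * (s.card : ℝ)⁻¹ := by
  rw [baryMap, Finsupp.linearCombination_apply, Finsupp.sum, Finsupp.finsetSum_apply,
    Finset.sum_filter]
  refine Finset.sum_congr rfl fun s _ => ?_
  rw [Finsupp.smul_apply, barycenter_apply]
  split_ifs <;> simp

theorem total_baryMap {y : Finset V →₀ ℝ} (h : ∀ s ∈ y.support, s.Nonempty) :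
    total V (baryMap V y) = total _ y := by
  rw [baryMap, Finsupp.linearCombination_apply, Finsupp.sum, map_sum, total_eq_sum subset_rfl]
  refine Finset.sum_congr rfl fun s hs => ?_
  rw [map_smul, total_barycenter (h s hs), smul_eq_mul, mul_one]

variable {y : Finset V →₀ ℝ}

theorem term_nonneg (hy : ∀ s, 0 ≤ y s) (s : Finset V) : 0 ≤ y s * (s.card : ℝ)⁻¹ :=
  mul_nonneg (hy s) (by positivity)

theorem term_pos (hy : ∀ s, 0 ≤ y s) {s : Finset V} (hs : s ∈ y.support) (hs' : s.Nonempty) :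
    0 < y s * (s.card : ℝ)⁻¹ := by
  have h1 : 0 < y s := (hy s).lt_of_ne' (Finsupp.mem_support_iff.1 hs)
  have h2 := Finset.card_pos.2 hs'
  positivity

theorem baryMap_nonneg (hy : ∀ s, 0 ≤ y s) (v : V) : 0 ≤ baryMap V y v := by
  classical
  rw [baryMap_apply]
  exact Finset.sum_nonneg fun s _ => term_nonneg hy s

theorem support_baryMap (hy : ∀ s, 0 ≤ y s) {u : Finset V} (hu : u ∈ y.support)
    (hmax : ∀ s ∈ y.support, s ⊆ u) : (baryMap V y).support = u := by
  classical
  ext v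
  rw [Finsupp.mem_support_iff, baryMap_apply]
  constructor
  · intro h
    obtain ⟨s, hs, -⟩ := Finset.exists_ne_zero_of_sum_ne_zero h
    exact hmax s (Finset.mem_filter.1 hs).1 (Finset.mem_filter.1 hs).2
  · intro hv
    refine (Finset.sum_pos' (fun s _ => term_nonneg hy s) ⟨u, ?_, ?_⟩).ne'
    · exact Finset.mem_filter.2 ⟨hu, hv⟩
    · exact term_pos hy hu ⟨v, hv⟩

/-- The coordinates of a point in the interior of the simplex of a chain are maximal exactly on the
smallest face of the chain. -/
theorem voronoiColors_baryMap {κ : Type*} (c : V → κ) (hy : ∀ s, 0 ≤ y s)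
    {l : Finset V} (hl : l ∈ y.support) (hl' : l.Nonempty) (hmin : ∀ s ∈ y.support, l ⊆ s) :
    voronoiColors c (baryMap V y) = c '' (l : Set V) := by
  classical
  have hle : ∀ v ∈ l, ∀ w, baryMap V y w ≤ baryMap V y v := by
    intro v hv w
    rw [baryMap_apply, baryMap_apply, Finset.filter_true_of_mem fun s hs => hmin s hs hv]
    exact Finset.sum_le_sum_of_subset_of_nonneg (Finset.filter_subset _ _)
      fun s _ _ => term_nonneg hy s
  have hpos : ∀ v ∈ l, 0 < baryMap V y v := by
    intro v hv
    rw [baryMap_apply]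
    exact Finset.sum_pos' (fun s _ => term_nonneg hy s)
      ⟨l, Finset.mem_filter.2 ⟨hl, hv⟩, term_pos hy hl hl'⟩
  ext j
  constructor
  · rintro ⟨v, -, hmaxv, rfl⟩
    refine ⟨v, ?_, rfl⟩
    by_contra hv
    obtain ⟨w, hw⟩ := hl'
    have := hmaxv w
    rw [baryMap_apply, baryMap_apply, Finset.filter_true_of_mem fun s hs => hmin s hs hw] at this
    refine absurd this (not_le.2 (Finset.sum_lt_sum_of_subset (Finset.filter_subset _ _) hl ?_ ?_
      fun s _ _ => term_nonneg hy s))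
    · exact fun h => hv (Finset.mem_filter.1 h).2
    · exact term_pos hy hl ⟨w, hw⟩
  · rintro ⟨v, hv, rfl⟩
    exact ⟨v, Finsupp.mem_support_iff.2 (hpos v hv).ne', hle v hv, rfl⟩

/-- Only the largest face `u` of a chain contributes to the smallest coordinate on `u`. -/
theorem top_coord_eq_min (hy : ∀ s, 0 ≤ y s) (hc : ∀ s ∈ y.support, ∀ t ∈ y.support, s ⊆ t ∨ t ⊆ s)
    (hne : ∀ s ∈ y.support, s.Nonempty) {u : Finset V} (hu : u ∈ y.support)
    (hmax : ∀ s ∈ y.support, s ⊆ u) :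
    (∀ v ∈ u, y u * (u.card : ℝ)⁻¹ ≤ baryMap V y v) ∧
      ∃ v ∈ u, baryMap V y v = y u * (u.card : ℝ)⁻¹ := by
  classical
  constructor
  · intro v hv
    rw [baryMap_apply]
    exact Finset.single_le_sum (f := fun s : Finset V => y s * (s.card : ℝ)⁻¹)
      (fun s _ => term_nonneg hy s) (Finset.mem_filter.2 ⟨hu, hv⟩)
  · obtain ⟨v, hv, hvs⟩ : ∃ v ∈ u, ∀ s ∈ y.support, s ≠ u → v ∉ s := by
      rcases (y.support.erase u).eq_empty_or_nonempty with h | h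
      · obtain ⟨v, hv⟩ := hne u hu
        refine ⟨v, hv, fun s hs hsu => ?_⟩
        have := Finset.mem_erase.2 ⟨hsu, hs⟩
        rw [h] at this
        simp at this
      · obtain ⟨u', hu', hmax'⟩ := exists_top h fun s hs t ht =>
          hc s (Finset.mem_of_mem_erase hs) t (Finset.mem_of_mem_erase ht)
        obtain ⟨v, hv, hv'⟩ := Finset.exists_of_ssubset ((hmax u'
          (Finset.mem_of_mem_erase hu')).ssubset_of_ne (Finset.ne_of_mem_erase hu'))
        exact ⟨v, hv, fun s hs hsu h => hv' (hmax' s (Finset.mem_erase.2 ⟨hsu, hs⟩) h)⟩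
    refine ⟨v, hv, ?_⟩
    rw [baryMap_apply]
    refine Finset.sum_eq_single_of_mem u (Finset.mem_filter.2 ⟨hu, hv⟩) fun s hs hsu => ?_
    exact absurd (Finset.mem_filter.1 hs).2 (hvs s (Finset.mem_filter.1 hs).1 hsu)

theorem baryMap_injOn (V : Type*) : Set.InjOn (baryMap V) {y | (∀ s, 0 ≤ y s) ∧
    (∀ s ∈ y.support, ∀ t ∈ y.support, s ⊆ t ∨ t ⊆ s) ∧ ∀ s ∈ y.support, s.Nonempty} := by
  classical
  rintro y ⟨hy, hyc, hyn⟩ z ⟨hz, hzc, hzn⟩ h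
  obtain ⟨n, hn⟩ : ∃ n, n = y.support.card := ⟨_, rfl⟩
  induction n generalizing y z with
  | zero =>
    have hy0 : y = 0 := Finsupp.support_eq_empty.1 (Finset.card_eq_zero.1 hn.symm)
    have := total_baryMap hzn
    rw [← h, hy0, map_zero, map_zero] at this
    rw [hy0, eq_zero_of_total_eq_zero hz this.symm]
  | succ n ih =>
    have hy0 : y.support.Nonempty := Finset.card_pos.1 (by omega)
    have hz0 : z.support.Nonempty := by
      rw [Finsupp.support_nonempty_iff]
      rintro rfl
      have := total_baryMap hyn
      rw [h, map_zero, map_zero] at this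
      rw [eq_zero_of_total_eq_zero hy this.symm] at hy0
      simp at hy0
    obtain ⟨u, hu, hum⟩ := exists_top hy0 hyc
    obtain ⟨u', hu', hum'⟩ := exists_top hz0 hzc
    obtain rfl : u = u' := by rw [← support_baryMap hy hu hum, h, support_baryMap hz hu' hum']
    obtain ⟨h1, v, hv, h2⟩ := top_coord_eq_min hy hyc hyn hu hum
    obtain ⟨h1', v', hv', h2'⟩ := top_coord_eq_min hz hzc hzn hu' hum'
    have hyz : y u = z u := by
      have hcard : (0 : ℝ) < (u.card : ℝ)⁻¹ := by
        have := Finset.card_pos.2 ⟨v, hv⟩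
        positivity
      have h3 := h1 v' hv'
      rw [h, h2'] at h3
      have h4 := h1' v hv
      rw [← h, h2] at h4
      exact (le_of_mul_le_mul_right h3 hcard).antisymm (le_of_mul_le_mul_right h4 hcard)
    have hsub : ∀ w : Finset V →₀ ℝ, (w.erase u).support ⊆ w.support := fun w => by
      rw [Finsupp.support_erase]; exact Finset.erase_subset _ _
    have hnn : ∀ w : Finset V →₀ ℝ, (∀ s, 0 ≤ w s) → ∀ s, 0 ≤ w.erase u s := by
      intro w hw s
      rw [Finsupp.erase_apply]
      split_ifs
      exacts [le_rfl, hw s]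
    have key := ih (hnn y hy) (fun s hs t ht => hyc s (hsub _ hs) t (hsub _ ht))
      (fun s hs => hyn s (hsub _ hs)) (hnn z hz)
      (fun s hs t ht => hzc s (hsub _ hs) t (hsub _ ht)) (fun s hs => hzn s (hsub _ hs)) ?_ ?_
    · rw [← Finsupp.single_add_erase u y, ← Finsupp.single_add_erase u z, key, hyz]
    · rw [← Finsupp.single_add_erase u y, ← Finsupp.single_add_erase u z, hyz, map_add,
        map_add] at h
      exact add_left_cancel h
    · rw [Finsupp.support_erase, Finset.card_erase_of_mem hu]
      omega

/-- Every point of a simplex lies in the realization of a chain of its faces: peel off the smallest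
coordinate on the support and induct. -/
theorem exists_baryMap_eq {x : V →₀ ℝ} (hx : ∀ v, 0 ≤ x v) :
    ∃ y : Finset V →₀ ℝ, baryMap V y = x ∧ (∀ s, 0 ≤ y s) ∧
      (∀ s ∈ y.support, ∀ t ∈ y.support, s ⊆ t ∨ t ⊆ s) ∧
      ∀ s ∈ y.support, s.Nonempty ∧ s ⊆ x.support := by
  classical
  obtain ⟨n, hn⟩ : ∃ n, n = x.support.card := ⟨_, rfl⟩
  induction n using Nat.strong_induction_on generalizing x with
  | _ n ih =>
    rcases x.support.eq_empty_or_nonempty with h0 | h0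
    · exact ⟨0, by simp [Finsupp.support_eq_empty.1 h0], by simp, by simp, by simp⟩
    · obtain ⟨a, ha, hmin⟩ := Finset.exists_min_image x.support x h0
      set u := x.support with hu
      have hcard : (u.card : ℝ) ≠ 0 := by exact_mod_cast (Finset.card_pos.2 h0).ne'
      let x' : V →₀ ℝ := x - (x a * u.card) • barycenter u
      have hx' : ∀ v, x' v = if v ∈ u then x v - x a else 0 := by
        intro v
        simp only [x', Finsupp.sub_apply, Finsupp.smul_apply, barycenter_apply]
        split_ifs with h
        · simp [hcard]
        · have : x v = 0 := Finsupp.notMem_support_iff.1 h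
          simp [this]
      have hsub : x'.support ⊂ u := by
        refine (Finset.ssubset_iff_of_subset fun v hv => ?_).2 ⟨a, ha, ?_⟩
        · rw [Finsupp.mem_support_iff, hx'] at hv
          by_contra hc
          simp [hc] at hv
        · simp [hx']
      obtain ⟨y, hy1, hy2, hy3, hy4⟩ := ih _ (hn ▸ Finset.card_lt_card hsub) (x := x') (fun v => by
        rw [hx']
        split_ifs with h
        exacts [sub_nonneg.2 (hmin v h), le_rfl]) rfl
      have hsupp : ∀ s ∈ (y + Finsupp.single u (x a * u.card)).support, s ∈ y.support ∨ s = u := by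
        intro s hs
        rcases Finset.mem_union.1 (Finsupp.support_add hs) with h | h
        · exact Or.inl h
        · exact Or.inr (by simpa using Finsupp.support_single_subset h)
      have hyu : ∀ s ∈ y.support, s ⊆ u := fun s hs => (hy4 s hs).2.trans hsub.subset
      refine ⟨y + Finsupp.single u (x a * u.card), ?_, fun s => ?_, ?_, ?_⟩
      · rw [map_add, hy1, baryMap, Finsupp.linearCombination_single]
        exact sub_add_cancel _ _
      · rw [Finsupp.add_apply, Finsupp.single_apply]
        have := hy2 s
        have := hx a
        split_ifs <;> positivity
      · intro s hs t ht
        rcases hsupp s hs with h | rfl <;> rcases hsupp t ht with h' | rfl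
        · exact hy3 s h t h'
        · exact Or.inl (hyu s h)
        · exact Or.inr (hyu t h')
        · exact Or.inl subset_rfl
      · intro s hs
        rcases hsupp s hs with h | rfl
        · exact ⟨(hy4 s h).1, hyu s h⟩
        · exact ⟨h0, subset_rfl⟩

theorem barycentricSubdivision_plHomeomorphic (hK : K.faces.Finite) :
    PLHomeomorphic (barycentricSubdivision K) K := by
  have hfin : (barycentricSubdivision K).faces.Finite := by
    refine (hK.toFinset.powerset.finite_toSet).subset ?_
    intro S hS
    rw [Finset.mem_coe, Finset.mem_powerset]
    exact fun s hs => hK.mem_toFinset.2 (hS.2.1 s hs)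
  refine plHomeomorphic_of_linear hfin (baryMap V) (fun y hy => ?_)
    ((baryMap_injOn V).mono fun y hy => ?_) fun x hx => ?_
  · obtain ⟨h0, h1, h2⟩ := mem_space.1 hy
    obtain ⟨u, hu, hmax⟩ := exists_top h1.1 h1.2.2
    rw [mem_space, support_baryMap h0 hu hmax,
      total_baryMap fun s hs => face_nonempty K (h1.2.1 s hs)]
    exact ⟨baryMap_nonneg h0, h1.2.1 u hu, h2⟩
  · obtain ⟨h0, h1, h2⟩ := mem_space.1 hy
    exact ⟨h0, h1.2.2, fun s hs => face_nonempty K (h1.2.1 s hs)⟩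
  · obtain ⟨h0, h1, h2⟩ := mem_space.1 hx
    obtain ⟨y, rfl, h3, h4, h5⟩ := exists_baryMap_eq h0
    have ht := total_baryMap fun s hs => (h5 s hs).1
    refine ⟨y, mem_space.2 ⟨h3, ⟨?_, fun s hs => face_of_subset K h1 (h5 s hs).2 (h5 s hs).1, h4⟩,
      by rw [← ht, h2]⟩, rfl⟩
    exact support_nonempty_of_total (by rw [← ht, h2])

theorem IsCombSphereOrDisk.barycentricSubdivision {p : Prop} {r : ℕ}
    (h : IsCombSphereOrDisk p r K) : IsCombSphereOrDisk p r (barycentricSubdivision K) := by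
  classical
  induction r using Nat.strong_induction_on generalizing K p with
  | _ r ih =>
    rcases r with _ | r
    · rw [isCombSphereOrDisk_zero] at h ⊢
      refine ⟨h.1, ?_⟩
      ext S
      simp only [Set.mem_empty_iff_false, iff_false]
      intro hS
      obtain ⟨s, hs⟩ := hS.1
      have := hS.2.1 s hs
      rw [h.2] at this
      exact this
    · rw [isCombSphereOrDisk_succ]
      refine ⟨fun s hs => ?_, (isCombSphereOrDisk_succ.1 h).2.of_plHomeomorphic
        (barycentricSubdivision_plHomeomorphic h.finite)⟩
      rw [← chains_faces] at hs ⊢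
      have hsK : s ∈ K.faces := singleton_mem_chains.1 hs
      have hsc := Finset.card_pos.2 (face_nonempty K hsK)
      obtain ⟨q, r', hq, hr', hlk⟩ := h.link hsK
      have hiso := link_chains_iso hs (Finset.mem_singleton_self s) (by simp)
      have hbelow : {t | t ∈ K.faces ∧ t ⊂ s} = (boundarySimplex s).faces := by
        ext t
        exact and_congr_left fun hts => ⟨face_nonempty K, face_of_subset K hsK hts.subset⟩
      rw [Finset.erase_singleton, link_empty, hbelow] at hiso
      refine ⟨False ∨ q, by simpa using hq, ?_⟩
      have hj := (ih (s.card - 1) (by omega)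
        (isCombSphereOrDisk_boundarySimplex s (face_nonempty K hsK))).join
        ((ih r' (by omega) hlk).of_iso (chains_above_iso s))
      rw [show s.card - 1 + r' = r by omega] at hj
      exact hj.of_iso hiso.symm

end Chains

/-! ### Color classes -/

section ColorClass

variable {V κ : Type*} {M : PreAbstractSimplicialComplex V} {c : V → κ} {C : Finset κ}

/-- The faces of `M` whose vertices have all the colors in `C`. -/
def colorfulFaces (M : PreAbstractSimplicialComplex V) (c : V → κ) (C : Finset κ) :
    Set (Finset V) :=
  {s | s ∈ M.faces ∧ ∀ j ∈ C, ∃ v ∈ s, c v = j}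

/-- The sets of vertices in `s` whose removal from `s` leaves all the colors in `C`. This is the join
of the boundaries of the simplices on the color classes of `s` for the colors in `C`, and of the
full simplex on the remaining vertices. -/
def removableFaces (s : Finset V) (c : V → κ) (C : Finset κ) : PreAbstractSimplicialComplex V where
  faces := {t | t.Nonempty ∧ t ⊆ s ∧ ∀ j ∈ C, ∃ v ∈ s, v ∉ t ∧ c v = j}
  isRelLowerSet_faces := fun _ h => ⟨h.1, fun _ hts ht => ⟨ht, hts.trans h.2.1, fun j hj =>
    let ⟨v, hv, hvt, hc⟩ := h.2.2 j hj
    ⟨v, hv, fun h' => hvt (hts h'), hc⟩⟩⟩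

theorem mem_removableFaces {s t : Finset V} : t ∈ (removableFaces s c C).faces ↔
    t.Nonempty ∧ t ⊆ s ∧ ∀ j ∈ C, ∃ v ∈ s, v ∉ t ∧ c v = j := Iff.rfl

theorem removableFaces_insert_iso [DecidableEq κ] {s A B : Finset V} {j : κ} (hj : j ∉ C)
    (hA : ∀ v, v ∈ A ↔ v ∈ s ∧ c v = j) (hB : ∀ v, v ∈ B ↔ v ∈ s ∧ c v ≠ j)
    (hs : ∃ v ∈ s, c v = j) (hC : ∀ i ∈ C, ∃ v ∈ s, c v = i) :
    Iso (join (boundarySimplex A) (removableFaces B c C))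
      (removableFaces s c (insert j C)) := by
  classical
  refine iso_iff.2 ⟨Sum.elim id id, fun v => if c v = j then Sum.inl v else Sum.inr v,
    fun T hT => ?_, fun U hU => ?_, ?_, fun v _ => ?_⟩
  · obtain ⟨h0, h1, h2⟩ := mem_join.1 hT
    have h1' : T.toLeft ⊂ A := by
      rcases h1 with h | h
      · rw [h, Finset.empty_ssubset]
        obtain ⟨v, hv, hvj⟩ := hs
        exact ⟨v, (hA v).2 ⟨hv, hvj⟩⟩
      · exact h.2
    have h2' : T.toRight ⊆ B ∧
        ∀ i ∈ C, ∃ v ∈ B, v ∉ T.toRight ∧ c v = i := by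
      rcases h2 with h | h
      · rw [h]
        refine ⟨Finset.empty_subset _, fun i hi => ?_⟩
        obtain ⟨v, hv, rfl⟩ := hC i hi
        exact ⟨v, (hB v).2 ⟨hv, fun h => hj (h ▸ hi)⟩, by simp, rfl⟩
      · exact h.2
    have hmem : ∀ v, v ∈ T.image (Sum.elim id id) ↔ v ∈ T.toLeft ∨ v ∈ T.toRight := by
      intro v
      simp
    refine mem_removableFaces.2 ⟨h0.image _, fun v hv => ?_, fun i hi => ?_⟩
    · rcases (hmem v).1 hv with h | h
      · exact ((hA v).1 (h1'.subset h)).1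
      · exact ((hB v).1 (h2'.1 h)).1
    · rcases Finset.mem_insert.1 hi with rfl | hi
      · obtain ⟨v, hv, hvT⟩ := Finset.exists_of_ssubset h1'
        rw [hA] at hv
        refine ⟨v, hv.1, fun h => ?_, hv.2⟩
        rcases (hmem v).1 h with h | h
        · exact hvT h
        · exact ((hB v).1 (h2'.1 h)).2 hv.2
      · obtain ⟨v, hv, hvT, rfl⟩ := h2'.2 i hi
        rw [hB] at hv
        refine ⟨v, hv.1, fun h => ?_, rfl⟩
        rcases (hmem v).1 h with h | h
        · exact hv.2 ((hA v).1 (h1'.subset h)).2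
        · exact hvT h
  · obtain ⟨h0, h1, h2⟩ := mem_removableFaces.1 hU
    have hl : (U.image fun v => if c v = j then Sum.inl v else Sum.inr v : Finset (V ⊕ V)).toLeft =
        U.filter (c · = j) := by
      ext v
      simp only [Finset.mem_toLeft, Finset.mem_image, Finset.mem_filter]
      constructor
      · rintro ⟨w, hw, h⟩
        split_ifs at h with h3
        obtain rfl := Sum.inl_injective h
        exact ⟨hw, h3⟩
      · rintro ⟨hv, h⟩
        exact ⟨v, hv, if_pos h⟩
    have hr : (U.image fun v => if c v = j then Sum.inl v else Sum.inr v : Finset (V ⊕ V)).toRight =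
        U.filter (c · ≠ j) := by
      ext v
      simp only [Finset.mem_toRight, Finset.mem_image, Finset.mem_filter]
      constructor
      · rintro ⟨w, hw, h⟩
        split_ifs at h with h3
        obtain rfl := Sum.inr_injective h
        exact ⟨hw, h3⟩
      · rintro ⟨hv, h⟩
        exact ⟨v, hv, if_neg h⟩
    rw [mem_join, hl, hr]
    refine ⟨h0.image _, ?_, ?_⟩
    · rw [or_iff_not_imp_left, ← ne_eq, ← Finset.nonempty_iff_ne_empty]
      refine fun hne => ⟨hne, (Finset.ssubset_iff_of_subset fun v hv => (hA v).2
        ⟨h1 (Finset.mem_filter.1 hv).1, (Finset.mem_filter.1 hv).2⟩).2 ?_⟩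
      obtain ⟨v, hv, hvU, hvj⟩ := h2 j (Finset.mem_insert_self j C)
      exact ⟨v, (hA v).2 ⟨hv, hvj⟩, fun h => hvU (Finset.mem_filter.1 h).1⟩
    · rw [or_iff_not_imp_left, ← ne_eq, ← Finset.nonempty_iff_ne_empty]
      refine fun hne => ⟨hne, fun v hv => (hB v).2
        ⟨h1 (Finset.mem_filter.1 hv).1, (Finset.mem_filter.1 hv).2⟩, fun i hi => ?_⟩
      obtain ⟨v, hv, hvU, rfl⟩ := h2 i (Finset.mem_insert_of_mem hi)
      exact ⟨v, (hB v).2 ⟨hv, fun h => hj (h ▸ hi)⟩,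
        fun h => hvU (Finset.mem_filter.1 h).1, rfl⟩
  · rintro (v | v) hv
    · rw [singleton_inl_mem_join] at hv
      have := ((hA v).1 (Finset.singleton_subset_iff.1 hv.2.subset)).2
      simp [this]
    · rw [singleton_inr_mem_join] at hv
      have := ((hB v).1 (Finset.singleton_subset_iff.1 hv.2.1)).2
      simp [this]
  · beta_reduce
    split_ifs <;> rfl

theorem card_le_of_forall_exists {s : Finset V} (hC : ∀ j ∈ C, ∃ v ∈ s, c v = j) :
    C.card ≤ s.card := by
  classical
  refine (Finset.card_le_card (t := s.image c) fun j hj => ?_).trans Finset.card_image_le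
  exact Finset.mem_image.2 (hC j hj)

theorem isCombSphereOrDisk_removableFaces {s : Finset V} (hC : ∀ j ∈ C, ∃ v ∈ s, c v = j) :
    IsCombSphereOrDisk (∃ v ∈ s, c v ∉ C) (s.card - C.card) (removableFaces s c C) := by
  classical
  induction C using Finset.induction_on generalizing s with
  | empty =>
    have h1 : removableFaces s c ∅ = fullSimplex s := by
      ext t
      simp [mem_removableFaces, mem_fullSimplex]
    rw [h1, Finset.card_empty, Nat.sub_zero]
    refine (isCombSphereOrDisk_fullSimplex s).congr ?_
    simp [Finset.Nonempty]
  | insert j C hj ih =>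
    have hs := hC j (Finset.mem_insert_self j C)
    have hC' : ∀ i ∈ C, ∃ v ∈ s, c v = i := fun i hi => hC i (Finset.mem_insert_of_mem hi)
    obtain ⟨A, hA⟩ : ∃ A : Finset V, A = s.filter fun v => c v = j := ⟨_, rfl⟩
    obtain ⟨B, hB⟩ : ∃ B : Finset V, B = s.filter fun v => ¬ c v = j := ⟨_, rfl⟩
    have hcard : A.card + B.card = s.card := by
      rw [hA, hB]
      exact Finset.card_filter_add_card_filter_not _
    have hA' : ∀ v, v ∈ A ↔ v ∈ s ∧ c v = j := by simp [hA]
    have hB' : ∀ v, v ∈ B ↔ v ∈ s ∧ c v ≠ j := by simp [hB]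
    have hC'' : ∀ i ∈ C, ∃ v ∈ B, c v = i := by
      intro i hi
      obtain ⟨v, hv, rfl⟩ := hC' i hi
      exact ⟨v, (hB' v).2 ⟨hv, fun h => hj (h ▸ hi)⟩, rfl⟩
    have hne : A.Nonempty := by
      obtain ⟨v, hv, hvj⟩ := hs
      exact ⟨v, (hA' v).2 ⟨hv, hvj⟩⟩
    have h1 := ((isCombSphereOrDisk_boundarySimplex A hne).join (ih hC'')).of_iso
      (removableFaces_insert_iso hj hA' hB' hs hC')
    have h2 := card_le_of_forall_exists hC''
    have h3 := Finset.card_pos.2 hne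
    rw [Finset.card_insert_of_notMem hj,
      show s.card - (C.card + 1) = A.card - 1 + (B.card - C.card) by omega]
    refine h1.congr ?_
    simp only [false_or, hB', Finset.mem_insert, not_or, and_assoc, ne_eq]

/-- Taking complements in `s` identifies the colorful proper subsets of `s` with the faces of
`removableFaces s c C`, reversing inclusions. -/
theorem removableFaces_iso_below [DecidableEq V] (hC : C.Nonempty) {s : Finset V}
    (hs : s ∈ colorfulFaces M c C) : Iso (barycentricSubdivision (removableFaces s c C))
      (chains {t | t ∈ colorfulFaces M c C ∧ t ⊂ s}) := by
  rw [← chains_faces]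
  refine chains_iso (fun t => s \ t) (fun t => s \ t) (fun t ht => ?_) (fun t ht => ?_)
    (fun t _ t' _ h => Or.inr (Finset.sdiff_subset_sdiff subset_rfl h))
    (fun t _ t' _ h => Or.inr (Finset.sdiff_subset_sdiff subset_rfl h))
  · obtain ⟨h0, h1, h2⟩ := mem_removableFaces.1 ht
    have h3 : ∀ j ∈ C, ∃ v ∈ s \ t, c v = j := by
      intro j hj
      obtain ⟨v, hv, hvt, hvj⟩ := h2 j hj
      exact ⟨v, Finset.mem_sdiff.2 ⟨hv, hvt⟩, hvj⟩
    refine ⟨⟨⟨face_of_subset M hs.1 Finset.sdiff_subset ?_, h3⟩,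
      Finset.sdiff_ssubset h1 h0⟩, Finset.sdiff_sdiff_eq_self h1⟩
    obtain ⟨j, hj⟩ := hC
    obtain ⟨v, hv, -⟩ := h3 j hj
    exact ⟨v, hv⟩
  · obtain ⟨h0, h1⟩ := ht
    refine ⟨⟨Finset.sdiff_nonempty.2 h1.2, Finset.sdiff_subset, fun j hj => ?_⟩,
      Finset.sdiff_sdiff_eq_self h1.subset⟩
    obtain ⟨v, hv, hvj⟩ := h0.2 j hj
    exact ⟨v, h1.subset hv, by simp [hv], hvj⟩

theorem colorfulFaces_above {s : Finset V} (hs : s ∈ colorfulFaces M c C) :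
    {t | t ∈ colorfulFaces M c C ∧ s ⊂ t} = {t | t ∈ M.faces ∧ s ⊂ t} := by
  ext t
  refine and_congr_left fun hst => ⟨fun h => h.1, fun h => ⟨h, fun j hj => ?_⟩⟩
  obtain ⟨v, hv, hvj⟩ := hs.2 j hj
  exact ⟨v, hst.subset hv, hvj⟩

theorem isCombSphereOrDisk_link_vertex {D : ℕ} {τ : Finset V → Prop}
    (hM : ∀ s ∈ M.faces, ∃ r, r + s.card = D ∧ IsCombSphereOrDisk (τ s) r (link M s))
    (hC : C.Nonempty) {s : Finset V} (hs : s ∈ colorfulFaces M c C) :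
    IsCombSphereOrDisk ((∃ v ∈ s, c v ∉ C) ∨ τ s) (D - C.card)
      (link (chains (colorfulFaces M c C)) {s}) := by
  classical
  obtain ⟨r, hr, hlk⟩ := hM s hs.1
  have hiso := link_chains_iso (singleton_mem_chains.2 hs) (Finset.mem_singleton_self s) (by simp)
  rw [Finset.erase_singleton, link_empty, colorfulFaces_above hs] at hiso
  have hj := ((isCombSphereOrDisk_removableFaces hs.2).barycentricSubdivision.of_iso
    (removableFaces_iso_below hC hs)).join (hlk.barycentricSubdivision.of_iso (chains_above_iso s))
  have := card_le_of_forall_exists hs.2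
  rw [show s.card - C.card + r = D - C.card by omega] at hj
  exact hj.of_iso hiso.symm

/-- The link of a chain of colorful faces is a disk if the smallest face of the chain has
additional colors or the link of its largest face is a disk, and a sphere otherwise. The induction
removes the largest face `u`: below `u`, the complex `M` may be replaced by the boundary of `u`. -/
theorem exists_isCombSphereOrDisk_link {D : ℕ} {τ : Finset V → Prop}
    (hM : ∀ s ∈ M.faces, ∃ r, r + s.card = D ∧ IsCombSphereOrDisk (τ s) r (link M s))
    (hC : C.Nonempty) {S : Finset (Finset V)} (hS : S ∈ (chains (colorfulFaces M c C)).faces)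
    {l u : Finset V} (hl : l ∈ S) (hmin : ∀ s ∈ S, l ⊆ s) (hu : u ∈ S) (hmax : ∀ s ∈ S, s ⊆ u) :
    ∃ r, IsCombSphereOrDisk ((∃ v ∈ l, c v ∉ C) ∨ τ u) r
      (link (chains (colorfulFaces M c C)) S) := by
  classical
  obtain ⟨n, hn⟩ : ∃ n, n = S.card := ⟨_, rfl⟩
  induction n generalizing M D τ S u with
  | zero =>
    have := Finset.card_eq_zero.1 hn.symm
    simp [this] at hl
  | succ n ih =>
    have huP := hS.2.1 u hu
    rcases (S.erase u).eq_empty_or_nonempty with h | h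
    · obtain rfl : S = {u} := by rw [← Finset.insert_erase hu, h]; rfl
      obtain rfl := Finset.mem_singleton.1 hl
      exact ⟨_, isCombSphereOrDisk_link_vertex hM hC huP⟩
    · have hSu : ∀ s ∈ S.erase u, s ⊂ u := fun s hs =>
        (hmax s (Finset.mem_of_mem_erase hs)).ssubset_of_ne (Finset.ne_of_mem_erase hs)
      have hbelow : {t | t ∈ colorfulFaces M c C ∧ t ⊂ u} =
          colorfulFaces (boundarySimplex u) c C := by
        ext t
        constructor
        · exact fun h => ⟨⟨face_nonempty M h.1.1, h.2⟩, h.1.2⟩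
        · exact fun h => ⟨⟨face_of_subset M huP.1 h.1.2.subset h.1.1, h.2⟩, h.1.2⟩
      have hS' : S.erase u ∈ (chains (colorfulFaces (boundarySimplex u) c C)).faces := by
        rw [← hbelow]
        exact ⟨h, fun s hs => ⟨hS.2.1 s (Finset.mem_of_mem_erase hs), hSu s hs⟩,
          fun s hs t ht => hS.2.2 s (Finset.mem_of_mem_erase hs) t (Finset.mem_of_mem_erase ht)⟩
      obtain ⟨u', hu', hmax'⟩ := exists_top h hS'.2.2
      have hlu : l ∈ S.erase u := by
        refine Finset.mem_erase.2 ⟨?_, hl⟩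
        rintro rfl
        obtain ⟨s, hs⟩ := h
        exact (hSu s hs).not_subset (hmin s (Finset.mem_of_mem_erase hs))
      have hbd : ∀ s ∈ (boundarySimplex u).faces, ∃ r, r + s.card = u.card - 1 ∧
          IsCombSphereOrDisk False r (link (boundarySimplex u) s) := by
        intro s hs
        obtain ⟨q, r, hq, hr, hlk⟩ :=
          (isCombSphereOrDisk_boundarySimplex u (face_nonempty M huP.1)).link hs
        exact ⟨r, hr, hlk.congr ⟨hq, False.elim⟩⟩
      obtain ⟨r, hr⟩ := ih hbd hS' hlu (fun s hs => hmin s (Finset.mem_of_mem_erase hs)) hu' hmax'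
        (by rw [Finset.card_erase_of_mem hu]; omega)
      obtain ⟨r', -, hlk⟩ := hM u huP.1
      have hiso := link_chains_iso hS hu hmax
      rw [hbelow, colorfulFaces_above huP] at hiso
      refine ⟨r + r', ((hr.join (hlk.barycentricSubdivision.of_iso (chains_above_iso u))).of_iso
        hiso.symm).congr ?_⟩
      rw [or_false]

theorem IsCombManifold.exists_link {d : ℕ} (hM : IsCombManifold d M) {s : Finset V}
    (hs : s ∈ M.faces) : ∃ r, r + s.card = d + 1 ∧
      IsCombSphereOrDisk (∃ r', IsCombDisk r' (link M s)) r (link M s) := by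
  classical
  obtain ⟨v, hv⟩ := face_nonempty M hs
  obtain ⟨q, hq⟩ := exists_isCombSphereOrDisk.1 (hM v (vertex_mem M hs hv))
  by_cases hsv : s = {v}
  · subst hsv
    exact ⟨d, by simp, hq.congr hq.iff_exists_isCombDisk⟩
  · have hss : {v} ⊂ s := (Finset.singleton_subset_iff.2 hv).ssubset_of_ne (Ne.symm hsv)
    obtain ⟨q', r', -, hr', h⟩ := hq.link (sdiff_mem_link hs hss)
    rw [link_link hss] at h
    refine ⟨r', ?_, h.congr h.iff_exists_isCombDisk⟩
    rw [Finset.card_sdiff_of_subset hss.subset, Finset.card_singleton] at hr'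
    have := Finset.card_pos.2 ⟨v, hv⟩
    omega

theorem mem_boundary_of_subset {d : ℕ} (hM : IsCombManifold d M) {s t : Finset V}
    (hs : s ∈ boundary M) (hts : t ⊆ s) (ht : t.Nonempty) : t ∈ boundary M := by
  classical
  have htM := face_of_subset M hs.1 hts ht
  refine ⟨htM, ?_⟩
  by_cases hst : t = s
  · exact hst ▸ hs.2
  · have hss := hts.ssubset_of_ne hst
    obtain ⟨r, -, h⟩ := hM.exists_link htM
    obtain ⟨q, r', hq, -, h'⟩ := h.link (sdiff_mem_link hs.1 hss)
    rw [link_link hss] at h'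
    exact hq (h'.iff_exists_isCombDisk.2 hs.2)

theorem lt_ncard_image_iff {l : Finset V} (hC : ∀ j ∈ C, ∃ v ∈ l, c v = j) :
    C.card < (c '' (l : Set V)).ncard ↔ ∃ v ∈ l, c v ∉ C := by
  have hfin : (c '' (l : Set V)).Finite := l.finite_toSet.image c
  rw [← Set.ncard_coe_finset C]
  constructor
  · intro h
    by_contra! hc
    refine absurd h (not_lt.2 (Set.ncard_le_ncard ?_ C.finite_toSet))
    rintro _ ⟨v, hv, rfl⟩
    exact hc v hv
  · rintro ⟨v, hv, hvC⟩
    refine Set.ncard_lt_ncard ⟨fun j hj => ?_, fun h => hvC (h ⟨v, hv, rfl⟩)⟩ hfin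
    obtain ⟨w, hw, hwj⟩ := hC j hj
    exact ⟨w, hw, hwj⟩

/-- The color class of `C` is covered by the realization of the order complex of the colorful faces:
the smallest face of the chain that carries a point has exactly the colors of the point. -/
theorem exists_baryMap_eq_of_mem_colorClass {x : V →₀ ℝ} (hx : x ∈ colorClass M c C) :
    ∃ y ∈ space (chains (colorfulFaces M c C)).faces, baryMap V y = x := by
  obtain ⟨hxM, hxC⟩ := hx
  obtain ⟨h0, h1, h2⟩ := mem_space.1 hxM
  obtain ⟨y, rfl, h3, h4, h5⟩ := exists_baryMap_eq h0
  have ht : total _ y = 1 := by rw [← h2, total_baryMap fun s hs => (h5 s hs).1]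
  have hne := support_nonempty_of_total ht
  obtain ⟨l, hl, hmin⟩ := exists_bot hne h4
  rw [voronoiColors_baryMap c h3 hl (h5 l hl).1 hmin] at hxC
  refine ⟨y, mem_space.2 ⟨h3, ⟨hne, fun s hs => ⟨face_of_subset M h1 (h5 s hs).2 (h5 s hs).1,
    fun j hj => ?_⟩, h4⟩, ht⟩, rfl⟩
  obtain ⟨v, hv, hvj⟩ := hxC hj
  exact ⟨v, hmin s hs hv, hvj⟩

theorem baryMap_mem_colorClass {y : Finset V →₀ ℝ}
    (hy : y ∈ space (chains (colorfulFaces M c C)).faces) :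
    baryMap V y ∈ colorClass M c C := by
  obtain ⟨h0, h1, h2⟩ := mem_space.1 hy
  have hne : ∀ s ∈ y.support, s.Nonempty := fun s hs => face_nonempty M (h1.2.1 s hs).1
  obtain ⟨l, hl, hmin⟩ := exists_bot h1.1 h1.2.2
  obtain ⟨u, hu, hmax⟩ := exists_top h1.1 h1.2.2
  refine ⟨mem_space.2 ⟨baryMap_nonneg h0, ?_, by rw [total_baryMap hne, h2]⟩, ?_⟩
  · rw [support_baryMap h0 hu hmax]
    exact (h1.2.1 u hu).1
  · rw [voronoiColors_baryMap c h0 hl (hne l hl) hmin]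
    intro j hj
    obtain ⟨v, hv, hvj⟩ := (h1.2.1 l hl).2 j hj
    exact ⟨v, hv, hvj⟩

end ColorClass

end VoronoiColoring

theorem lemma2p4 {V : Type*} (d k m : ℕ) (hm : 1 ≤ m) (hmk : m ≤ k) (hkd : k ≤ d)
    (M : PreAbstractSimplicialComplex V) (hM : IsCombManifold d M)
    (c : V → Fin k) (C : Finset (Fin k)) (hC : C.card = m) :
    ∃ X : PreAbstractSimplicialComplex (Finset V),
      X ≤ barycentricSubdivision M ∧
      subdivisionSpace X.faces = colorClass M c C ∧
      IsCombManifold (d - m + 1) X ∧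
      subdivisionSpace (boundary X) =
        (colorClass M c C ∩ space (boundary M)) ∪
          {x ∈ colorClass M c C | m < (voronoiColors c x).ncard} := by
  subst hC
  have hC : C.Nonempty := Finset.card_pos.1 hm
  have hlink := fun s hs => hM.exists_link (s := s) hs
  refine ⟨chains (colorfulFaces M c C), fun S hS => ⟨hS.1, fun s hs => (hS.2.1 s hs).1, hS.2.2⟩,
    ?_, fun s hs => ?_, ?_⟩
  · ext x
    constructor
    · rintro ⟨y, hy, rfl⟩
      exact baryMap_mem_colorClass hy
    · intro hx
      obtain ⟨y, hy, rfl⟩ := exists_baryMap_eq_of_mem_colorClass hx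
      exact ⟨y, hy, rfl⟩
  · have h := isCombSphereOrDisk_link_vertex hlink hC (singleton_mem_chains.1 hs)
    rw [show d + 1 - C.card = d - C.card + 1 by omega] at h
    exact exists_isCombSphereOrDisk.2 ⟨_, h⟩
  · ext x
    constructor
    · rintro ⟨y, hy, rfl⟩
      simp only [space, Set.mem_iUnion] at hy
      obtain ⟨S, hS, hyS⟩ := hy
      obtain ⟨hSX, hSd⟩ := hS
      obtain ⟨h0, h1, h2⟩ := mem_geomSimplex.1 hyS
      have hne := support_nonempty_of_total h2
      have hyX : y.support ∈ (chains (colorfulFaces M c C)).faces := face_of_subset _ hSX h1 hne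
      have hx := baryMap_mem_colorClass (mem_space.2 ⟨h0, hyX, h2⟩)
      obtain ⟨l, hl, hmin⟩ := exists_bot hSX.1 hSX.2.2
      obtain ⟨u, hu, hmax⟩ := exists_top hSX.1 hSX.2.2
      obtain ⟨l', hl', hmin'⟩ := exists_bot hyX.1 hyX.2.2
      obtain ⟨u', hu', hmax'⟩ := exists_top hyX.1 hyX.2.2
      obtain ⟨r, hr⟩ := exists_isCombSphereOrDisk_link hlink hC hSX hl hmin hu hmax
      rcases hr.iff_exists_isCombDisk.2 hSd with ⟨v, hv, hvC⟩ | hud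
      · refine Or.inr ⟨hx, ?_⟩
        change _ < (voronoiColors c (baryMap V y)).ncard
        rw [voronoiColors_baryMap c h0 hl' (face_nonempty M (hyX.2.1 l' hl').1) hmin',
          lt_ncard_image_iff (hyX.2.1 l' hl').2]
        exact ⟨v, hmin l' (h1 hl') hv, hvC⟩
      · refine Or.inl ⟨hx, ?_⟩
        obtain ⟨h3, h4, h5⟩ := mem_space.1 hx.1
        simp only [space, Set.mem_iUnion]
        refine ⟨u, ⟨(hSX.2.1 u hu).1, hud⟩, mem_geomSimplex.2 ⟨h3, ?_, h5⟩⟩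
        change (baryMap V y).support ⊆ u
        rw [support_baryMap h0 hu' hmax']
        exact hmax u' (h1 hu')
    · intro hx
      have hxX : x ∈ colorClass M c C := hx.elim (fun h => h.1) fun h => h.1
      obtain ⟨y, hy, rfl⟩ := exists_baryMap_eq_of_mem_colorClass hxX
      obtain ⟨h0, hyX, h2⟩ := mem_space.1 hy
      obtain ⟨l, hl, hmin⟩ := exists_bot hyX.1 hyX.2.2
      obtain ⟨u, hu, hmax⟩ := exists_top hyX.1 hyX.2.2
      obtain ⟨r, hr⟩ := exists_isCombSphereOrDisk_link hlink hC hyX hl hmin hu hmax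
      refine ⟨y, ?_, rfl⟩
      simp only [space, Set.mem_iUnion]
      refine ⟨y.support, ⟨hyX, hr.iff_exists_isCombDisk.1 ?_⟩,
        mem_geomSimplex.2 ⟨h0, subset_rfl, h2⟩⟩
      rcases hx with ⟨-, hxB⟩ | ⟨-, hxc⟩
      · right
        simp only [space, Set.mem_iUnion] at hxB
        obtain ⟨s, hs, hxs⟩ := hxB
        have hus := (mem_geomSimplex.1 hxs).2.1
        rw [support_baryMap h0 hu hmax] at hus
        exact (mem_boundary_of_subset hM hs hus (face_nonempty M (hyX.2.1 u hu).1)).2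
      · left
        rwa [voronoiColors_baryMap c h0 hl (face_nonempty M (hyX.2.1 l hl).1) hmin,
          lt_ncard_image_iff (hyX.2.1 l hl).2] at hxc
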